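/- Let $\delta, T, K>0$, let $V:\mathbb R\to\mathbb R$ be $C^3$ with $V',V'',V'''$ bounded (for instance the double-well potential $\frac14(\varphi^2-1)^2$, modified smoothly outside a large interval), and let $\varphi_-\in C^2([0,1])$ with $\varphi_-(0)=\varphi_-(1)=0$ (for instance a stationary state of $\varphi_t=\delta\varphi_{xx}-\delta^{-1}V'(\varphi)$ with Dirichlet boundary conditions). Write $(\cdot,\cdot)$ and $\|\cdot\|$ for the inner product and norm of $L^2(0,1)$, and put $h(\alpha)=\frac12\|\alpha\|^2$ and $g(\varphi)=K\|\varphi-\varphi_-\|^2$. For $\Delta x=1/M$, $M\ge 1$ an integer, let $V_{\Delta x}$ be the space of continuous functions on $[0,1]$ that vanish at $0$ and $1$ and are affine on every interval $[i\Delta x,(i+1)\Delta x]$. For $\bar\varphi_0\in V_{\Delta x}$ let $$\bar u(\bar\varphi_0,0)=\inf_{\bar\alpha\in L^2(0,T;V_{\Delta x})}\Big\{g(\bar\varphi(T))+\int_0^T h(\bar\alpha)\,dt\Big\},$$ where $\bar\varphi\in C([0,T];V_{\Delta x})$, $\bar\varphi(0)=\bar\varphi_0$, solves $$(\bar\varphi_t,v)=-\delta(\bar\varphi_x,v_x)+(-\delta^{-1}V'(\bar\varphi)+\bar\alpha,v)\quad\text{for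 all } v\in V_{\Delta x}.$$ For $\Delta t=T/N$, $N\ge 1$ an integer, and $t_n=n\Delta t$, let $$\tilde u(\bar\varphi_0,0)=\inf_{\{\tilde\alpha^n\}_{n=0}^{N-1}\subset V_{\Delta x}}\Big\{g(\tilde\varphi^N)+\Delta t\sum_{n=0}^{N-1}h(\tilde\alpha^n)\Big\},$$ where $\tilde\varphi^0=\bar\varphi_0$ and $\{\tilde\varphi^n\}_{n=0}^N\subset V_{\Delta x}$ is the forward Euler state $$(\tilde\varphi^{n+1},v)=(\tilde\varphi^n,v)+\Delta t\big(-\delta(\tilde\varphi^n_x,v_x)+(-\delta^{-1}V'(\tilde\varphi^n)+\tilde\alpha^n,v)\big)\quad\text{for all } v\in V_{\Delta x}.$$ For every constant $C$ there is a constant $D$, depending only on $C,\delta,T,K,V,\varphi_-$ (in particular not on $\Delta x$ and $\Delta t$), with the following property. Let $r:(0,\infty)\to(0,\infty)$, and for every $\Delta x$ let a starting position $\bar\varphi_0=\bar\varphi_0^{\Delta x}\in V_{\Delta x}$ be given that satisfies the discrete stationarity condition $$\delta\big((\bar\varphi_0)_x,v_x\big)+\delta^{-1}\big(V'(\bar\varphi_0),v\big)=0\quad\text{for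 all } v\in V_{\Delta x}.$$ Assume that for all $\Delta x$ and $\Delta t$ with $\Delta t\le r(\Delta x)$ there are - an optimal pair $\{\tilde\alpha^n\},\{\tilde\varphi^n\}$ for $\tilde u(\bar\varphi_0,0)$, and - a continuous optimal control $\bar\alpha$ for $\bar u(\bar\varphi_0,0)$, with the forward Euler state $\{\mathring\varphi^n\}_{n=0}^N$ that starts in $\mathring\varphi^0=\bar\varphi_0$ and uses the control values $\bar\alpha(t_n)$, such that $$\|\tilde\varphi^{n+1}_x-\tilde\varphi^n_x\|+\|\mathring\varphi^{n+1}_x-\mathring\varphi^n_x\|\le C\Delta t\quad\text{for all } 0\le n<N.$$ Then $$|\tilde u(\bar\varphi_0,0)-\bar u(\bar\varphi_0,0)|\le D\,\Delta t\quad\text{for all }\Delta x,\Delta t\text{ with }\Delta t\le r(\Delta x).$$ -/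

import Mathlib

open scoped BoundedContinuousFunction

namespace GinzburgLandau

noncomputable section

/-- The `L²(0,1)` inner product. -/
def l2Inner (f g : ℝ → ℝ) : ℝ := ∫ x in (0 : ℝ)..1, f x * g x

/-- The `L²(0,1)` norm. -/
def l2Norm (f : ℝ → ℝ) : ℝ := Real.sqrt (l2Inner f f)

/-- The finite element space with mesh size `1 / M`: continuous functions on `[0,1]`, zero at `0` and
at `1`, and affine on each cell `[i / M, (i + 1) / M]`. Its elements are extended by zero to `ℝ`. As a
normed space it carries the supremum norm (the space is finite dimensional for `M ≥ 1`, so that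
continuity in time and `L²` in time do not depend on this choice). -/
def feSpace (M : ℕ) : Submodule ℝ (ℝ →ᵇ ℝ) where
  carrier := {φ | (∀ x, x ∉ Set.Ioo (0 : ℝ) 1 → φ x = 0) ∧
    ∀ i : ℕ, i < M → ∃ a b : ℝ, ∀ x ∈ Set.Icc ((i : ℝ) / M) (((i : ℝ) + 1) / M), φ x = a * x + b}
  zero_mem' := ⟨fun _ _ => rfl, fun _ _ => ⟨0, 0, fun x _ => by simp⟩⟩
  add_mem' := by
    rintro φ ψ ⟨h1, h2⟩ ⟨k1, k2⟩
    refine ⟨fun x hx => by simp [h1 x hx, k1 x hx], fun i hi => ?_⟩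
    obtain ⟨a, b, h⟩ := h2 i hi
    obtain ⟨c, d, k⟩ := k2 i hi
    refine ⟨a + c, b + d, fun x hx => ?_⟩
    rw [BoundedContinuousFunction.add_apply, h x hx, k x hx]
    ring
  smul_mem' := by
    rintro c φ ⟨h1, h2⟩
    refine ⟨fun x hx => by simp [h1 x hx], fun i hi => ?_⟩
    obtain ⟨a, b, h⟩ := h2 i hi
    refine ⟨c * a, c * b, fun x hx => ?_⟩
    rw [BoundedContinuousFunction.smul_apply, h x hx, smul_eq_mul]
    ring

/-- The function on `ℝ` underlying an element of the finite element space. -/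
def feFun {M : ℕ} (φ : feSpace M) : ℝ → ℝ := fun x => (φ : ℝ →ᵇ ℝ) x

/-- The spatial derivative `φ_x` (defined off the mesh points, hence almost everywhere). -/
def feDeriv {M : ℕ} (φ : feSpace M) : ℝ → ℝ := deriv (feFun φ)

/-- The weak right hand side `-δ (φ_x, v_x) + (-δ⁻¹ V'(φ) + α, v)` of the controlled equation. -/
def weakRHS (δ : ℝ) (V : ℝ → ℝ) {M : ℕ} (φ α v : feSpace M) : ℝ :=
  -δ * l2Inner (feDeriv φ) (feDeriv v)
    + l2Inner (fun x => -δ⁻¹ * deriv V (feFun φ x) + feFun α x) (feFun v)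

/-- Discrete stationarity: `δ (φ_x, v_x) + δ⁻¹ (V'(φ), v) = 0` for all `v` in the space. -/
def IsStationary (δ : ℝ) (V : ℝ → ℝ) {M : ℕ} (φ : feSpace M) : Prop :=
  ∀ v : feSpace M,
    δ * l2Inner (feDeriv φ) (feDeriv v)
      + δ⁻¹ * l2Inner (fun x => deriv V (feFun φ x)) (feFun v) = 0

/-- The running cost `h(α) = ‖α‖² / 2`. -/
def runningCost {M : ℕ} (α : feSpace M) : ℝ := l2Norm (feFun α) ^ 2 / 2

/-- The final cost `g(φ) = K ‖φ - φ₋‖²`. -/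
def finalCost (K : ℝ) (φm : ℝ → ℝ) {M : ℕ} (φ : feSpace M) : ℝ :=
  K * l2Norm (fun x => feFun φ x - φm x) ^ 2

/-- `φ` is the semi-discrete state on `[t₀, T]` with control `α` started in `φ₀` at time `t₀`: it is
continuous and solves `(φ_t, v) = -δ (φ_x, v_x) + (-δ⁻¹ V'(φ) + α, v)` for all `v` in the space, in
the sense of Carathéodory (the time-integrated equation). -/
structure IsSemiState (δ : ℝ) (V : ℝ → ℝ) (T : ℝ) {M : ℕ} (φ₀ : feSpace M) (t₀ : ℝ)
    (α φ : ℝ → feSpace M) : Prop where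
  continuousOn : ContinuousOn φ (Set.Icc t₀ T)
  init : φ t₀ = φ₀
  evol : ∀ t ∈ Set.Icc t₀ T, ∀ v : feSpace M,
    l2Inner (feFun (φ t)) (feFun v) =
      l2Inner (feFun φ₀) (feFun v) + ∫ s in t₀..t, weakRHS δ V (φ s) (α s) v

/-- The pair `(α, φ)` is admissible on `[t₀, T]`: the control is in `L²(t₀, T)` with values in the
finite element space, and `φ` is its state. -/
def IsSemiAdmissible (δ : ℝ) (V : ℝ → ℝ) (T : ℝ) {M : ℕ} (φ₀ : feSpace M) (t₀ : ℝ)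
    (α φ : ℝ → feSpace M) : Prop :=
  MeasureTheory.MemLp α 2 (MeasureTheory.volume.restrict (Set.Ioc t₀ T)) ∧
    IsSemiState δ V T φ₀ t₀ α φ

/-- The cost `g(φ(T)) + ∫ h(α) dt` of a semi-discrete pair. -/
def semiCost (K : ℝ) (φm : ℝ → ℝ) (T : ℝ) {M : ℕ} (t₀ : ℝ) (α φ : ℝ → feSpace M) : ℝ :=
  finalCost K φm (φ T) + ∫ t in t₀..T, runningCost (α t)

/-- The semi-discrete value function `ū(φ₀, t₀)`. -/
def semiValue (δ : ℝ) (V : ℝ → ℝ) (K : ℝ) (φm : ℝ → ℝ) (T : ℝ) {M : ℕ} (φ₀ : feSpace M)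
    (t₀ : ℝ) : ℝ :=
  sInf {c | ∃ α φ : ℝ → feSpace M, IsSemiAdmissible δ V T φ₀ t₀ α φ ∧ c = semiCost K φm T t₀ α φ}

/-- `(α, φ)` is an optimal pair for `ū(φ₀, t₀)`. -/
def IsSemiOptimal (δ : ℝ) (V : ℝ → ℝ) (K : ℝ) (φm : ℝ → ℝ) (T : ℝ) {M : ℕ} (φ₀ : feSpace M)
    (t₀ : ℝ) (α φ : ℝ → feSpace M) : Prop :=
  IsSemiAdmissible δ V T φ₀ t₀ α φ ∧ semiCost K φm T t₀ α φ = semiValue δ V K φm T φ₀ t₀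

/-- `φ m, …, φ N` is the forward Euler state with step `T / N` and control `α m, …, α (N - 1)`,
started in `φ₀` at step `m`. -/
def IsEulerState (δ : ℝ) (V : ℝ → ℝ) (T : ℝ) (N : ℕ) {M : ℕ} (φ₀ : feSpace M) (m : ℕ)
    (α φ : ℕ → feSpace M) : Prop :=
  φ m = φ₀ ∧ ∀ n, m ≤ n → n < N → ∀ v : feSpace M,
    l2Inner (feFun (φ (n + 1))) (feFun v) =
      l2Inner (feFun (φ n)) (feFun v) + T / N * weakRHS δ V (φ n) (α n) v

/-- The cost `g(φ_N) + Δt ∑ h(α_n)` of a time-discrete pair, with `Δt = T / N`. -/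
def eulerCost (K : ℝ) (φm : ℝ → ℝ) (T : ℝ) (N : ℕ) {M : ℕ} (m : ℕ) (α φ : ℕ → feSpace M) : ℝ :=
  finalCost K φm (φ N) + T / N * ∑ n ∈ Finset.Ico m N, runningCost (α n)

/-- The time-discrete value function `ũ(φ₀, t_m)`, where `t_m = m T / N`. -/
def eulerValue (δ : ℝ) (V : ℝ → ℝ) (K : ℝ) (φm : ℝ → ℝ) (T : ℝ) (N : ℕ) {M : ℕ} (φ₀ : feSpace M)
    (m : ℕ) : ℝ :=
  sInf {c | ∃ α φ : ℕ → feSpace M, IsEulerState δ V T N φ₀ m α φ ∧ c = eulerCost K φm T N m α φ}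

/-- `(α, φ)` is an optimal pair for `ũ(φ₀, t_m)`. -/
def IsEulerOptimal (δ : ℝ) (V : ℝ → ℝ) (K : ℝ) (φm : ℝ → ℝ) (T : ℝ) (N : ℕ) {M : ℕ}
    (φ₀ : feSpace M) (m : ℕ) (α φ : ℕ → feSpace M) : Prop :=
  IsEulerState δ V T N φ₀ m α φ ∧ eulerCost K φm T N m α φ = eulerValue δ V K φm T N φ₀ m

/-- The growth condition with constant `C` for mesh size `1 / M` and time step `T / N`: there are
an optimal Euler state `φt` for `ũ(φ₀, 0)`, and an Euler state `φr` driven by the values at the grid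
points of a (continuous) optimal control `αb` for `ū(φ₀, 0)`, such that the `L²` norms of the spatial
derivatives of their increments sum to at most `C Δt` in every step. -/
def GradIncrease (δ : ℝ) (V : ℝ → ℝ) (K : ℝ) (φm : ℝ → ℝ) (T : ℝ) (N : ℕ) {M : ℕ}
    (φ₀ : feSpace M) (C : ℝ) : Prop :=
  ∃ (αt φt : ℕ → feSpace M) (αb φb : ℝ → feSpace M) (φr : ℕ → feSpace M),
    IsEulerOptimal δ V K φm T N φ₀ 0 αt φt ∧
    IsSemiOptimal δ V K φm T φ₀ 0 αb φb ∧
    ContinuousOn αb (Set.Icc 0 T) ∧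
    IsEulerState δ V T N φ₀ 0 (fun n => αb (n * (T / N))) φr ∧
    ∀ n < N,
      l2Norm (fun x => feDeriv (φt (n + 1)) x - feDeriv (φt n) x)
        + l2Norm (fun x => feDeriv (φr (n + 1)) x - feDeriv (φr n) x) ≤ C * (T / N)

end

end GinzburgLandau

/-!
The argument takes place in the finite element space with the `L²(0,1)` inner product, a finite
dimensional Hilbert space in which the semidiscrete equation reads `φ' = -A φ - f φ + α`, with a
symmetric coercive operator `A` (the stiffness operator) and a Lipschitz nonlinearity `f`. No norm
of `A` may enter the estimates, since it grows with the number of cells; what is available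
uniformly in the mesh is the coercivity of `A`, the Lipschitz constant of `f`, and the growth
condition, which says that the Euler increments are `O(τ)` in the energy form `⟪A u, u⟫`, `τ` being
the time step. Both value functions are bounded because the stationary starting position costs a
bounded amount without control.

The semidiscrete value exceeds the Euler value by `O(τ)` at most
(`ParabolicSystem.exists_state_cost_le`): let `(α n, φ n)` be an optimal Euler pair and let `y`
solve the *linear* equation `y' = -A y - f (φ n) + α n` on the `n`-th step. The energy identity for
the difference to the Euler interpolant only involves increments in the energy form, which the
dissipation absorbs. So `y - φ n = O(τ)`, and `y` is the state of the control
`α n + f y - f (φ n)`, which is `O(τ)`-close to `α n`.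

The Euler value exceeds the semidiscrete value by `O(τ)` at most (`ParabolicSystem.euler_cost_le`):
an optimal control `α` with state `φ` is sampled at the grid points. Since the control acts on the
whole space, every `C¹` curve with the right starting point is a state, and the Pontryagin
principle is the Euler–Lagrange equation of a problem in the calculus of variations
(`ParabolicSystem.euler_lagrange`): `α' = A α + df(φ) α` with `α T = -2 K (φ T - p)`, where `p` is
the projection of the target profile. Its energy identity bounds `∫ ⟪A α, α⟫` uniformly in the mesh
and shows that `‖α t‖² + 2 L ∫ ‖α‖²` is nondecreasing. The latter controls the Riemann sum of the
running cost, the former the increments of the control when tested with the state error, and a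
Grönwall argument over the steps concludes.
-/

namespace GinzburgLandau

open scoped InnerProductSpace

/-! ### Differential inequalities and linear evolution equations -/

/-- Grönwall's inequality on one time step, for a differential inequality that holds in the interior
of the step only. -/
theorem gronwall_of_hasDerivAt_Ioo {E E' : ℝ → ℝ} {s t a b : ℝ} (hst : s ≤ t) (ha : 0 ≤ a)
    (hb : 0 ≤ b) (hc : ContinuousOn E (Set.Icc s t))
    (hd : ∀ x ∈ Set.Ioo s t, HasDerivAt E (E' x) x)
    (h : ∀ x ∈ Set.Ioo s t, E' x ≤ a * E x + b) :
    E t ≤ Real.exp (a * (t - s)) * (E s + (t - s) * b) := by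
  -- The integrating factor is at most `1`, so that `b` may be subtracted without a factor.
  have hG : AntitoneOn (fun x => Real.exp (-(a * (x - s))) * E x - b * (x - s))
      (Set.Icc s t) := by
    have hder : ∀ x ∈ Set.Ioo s t,
        HasDerivAt (fun x => Real.exp (-(a * (x - s))) * E x - b * (x - s))
          (Real.exp (-(a * (x - s))) * (E' x - a * E x) - b) x := by
      intro x hx
      have h1 : HasDerivAt (fun x => -(a * (x - s))) (-(a * 1)) x :=
        (((hasDerivAt_id x).sub_const s).const_mul a).neg
      have h2 : HasDerivAt (fun x => b * (x - s)) (b * 1) x :=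
        ((hasDerivAt_id x).sub_const s).const_mul b
      refine ((h1.exp.mul (hd x hx)).sub h2).congr_deriv ?_
      ring
    refine antitoneOn_of_deriv_nonpos (convex_Icc s t) ?_ ?_ ?_
    · exact ((Continuous.continuousOn (by fun_prop)).mul hc).sub
        (Continuous.continuousOn (by fun_prop))
    · rw [interior_Icc]
      exact fun x hx => (hder x hx).differentiableAt.differentiableWithinAt
    · rw [interior_Icc]
      intro x hx
      rw [(hder x hx).deriv]
      have h1 : Real.exp (-(a * (x - s))) ≤ 1 := by
        rw [Real.exp_le_one_iff]
        nlinarith [hx.1]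
      have h2 := h x hx
      have h3 := Real.exp_pos (-(a * (x - s)))
      nlinarith
  have := hG ⟨le_rfl, hst⟩ ⟨hst, le_rfl⟩ hst
  simp only [sub_self, mul_zero, neg_zero, Real.exp_zero, one_mul, sub_zero] at this
  have h4 : E t = Real.exp (a * (t - s)) * (Real.exp (-(a * (t - s))) * E t) := by
    rw [← mul_assoc, ← Real.exp_add]
    simp
  rw [h4]
  refine mul_le_mul_of_nonneg_left ?_ (Real.exp_pos _).le
  linarith

/-- On the open step `(n τ, (n + 1) τ)` the step counter `⌊t / τ⌋₊` equals `n`. -/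
theorem floor_div_eq_of_mem_Ioo {τ t : ℝ} (hτ : 0 < τ) {n : ℕ}
    (ht : t ∈ Set.Ioo (n * τ) ((n + 1) * τ)) : ⌊t / τ⌋₊ = n := by
  rw [Nat.floor_eq_iff]
  · exact ⟨(le_div_iff₀ hτ).2 ht.1.le, (div_lt_iff₀ hτ).2 ht.2⟩
  · have : (0 : ℝ) ≤ n * τ := by positivity
    exact div_nonneg (this.trans ht.1.le) hτ.le

theorem stronglyMeasurable_step {E : Type*} [TopologicalSpace E] (Q : ℕ → E) (τ : ℝ) :
    MeasureTheory.StronglyMeasurable fun t : ℝ => Q ⌊t / τ⌋₊ :=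
  (MeasureTheory.StronglyMeasurable.of_discrete (f := Q)).comp_measurable
    (Nat.measurable_floor.comp (measurable_id.div_const τ))

/-- The linear evolution equation `y' = -A y + Q n` on the `n`-th time step, solved by the variation
of constants formula. -/
theorem exists_linear_flow {E : Type*} [NormedAddCommGroup E] [NormedSpace ℝ E] [CompleteSpace E]
    (A : E →L[ℝ] E) (y₀ : E) {τ : ℝ} (hτ : 0 < τ) (Q : ℕ → E) {B : ℝ} (hQ : ∀ n, ‖Q n‖ ≤ B) :
    ∃ y : ℝ → E, Continuous y ∧ y 0 = y₀ ∧
      ∀ n : ℕ, ∀ t ∈ Set.Ioo (n * τ) ((n + 1) * τ), HasDerivAt y (-A (y t) + Q n) t := by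
  set S : ℝ → E →L[ℝ] E := fun t => NormedSpace.exp (t • A) with hS
  have hSd : ∀ t, HasDerivAt S (A * S t) t := fun t => hasDerivAt_exp_smul_const' A t
  have hSc : Continuous S := continuous_iff_continuousAt.2 fun t => (hSd t).continuousAt
  have hSinv : ∀ t, S (-t) * S t = 1 := by
    intro t
    have hcomm : Commute ((-t) • A) (t • A) := by
      rw [neg_smul]
      exact (Commute.refl _).neg_left
    let _ : NormedAlgebra ℚ (E →L[ℝ] E) := NormedAlgebra.restrictScalars ℚ ℝ _
    rw [hS]
    dsimp only
    rw [← NormedSpace.exp_add_of_commute hcomm]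
    simp
  set q : ℝ → E := fun t => S t (Q ⌊t / τ⌋₊) with hq
  have hqm : MeasureTheory.StronglyMeasurable q := by
    have h1 := hSc.stronglyMeasurable.prodMk (stronglyMeasurable_step Q τ)
    exact Continuous.comp_stronglyMeasurable
      (isBoundedBilinearMap_apply (𝕜 := ℝ) (E := E) (F := E)).continuous h1
  have hqi : ∀ a b, IntervalIntegrable q MeasureTheory.volume a b := by
    intro a b
    have h1 : IntervalIntegrable (fun t => ‖S t‖ * B) MeasureTheory.volume a b :=
      Continuous.intervalIntegrable (by fun_prop) a b
    refine h1.mono_fun' hqm.aestronglyMeasurable (Filter.Eventually.of_forall fun t => ?_)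
    exact ((S t).le_opNorm _).trans (mul_le_mul_of_nonneg_left (hQ _) (norm_nonneg _))
  set w : ℝ → E := fun t => y₀ + ∫ s in (0 : ℝ)..t, q s with hw
  have hwc : Continuous w := continuous_const.add (intervalIntegral.continuous_primitive hqi 0)
  refine ⟨fun t => S (-t) (w t), ?_, ?_, ?_⟩
  · exact (hSc.comp continuous_neg).clm_apply hwc
  · simp [hw, hS]
  · intro n t ht
    have hwd : HasDerivAt w (S t (Q n)) t := by
      have hev : q =ᶠ[nhds t] fun s => S s (Q n) := by
        filter_upwards [isOpen_Ioo.mem_nhds ht] with s hs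
        simp only [hq]
        rw [floor_div_eq_of_mem_Ioo hτ hs]
      have hct : ContinuousAt q t :=
        ContinuousAt.congr (Continuous.continuousAt (hSc.clm_apply continuous_const)) hev.symm
      have := (intervalIntegral.integral_hasDerivAt_right (hqi 0 t)
        hqm.stronglyMeasurableAtFilter hct).const_add y₀
      rwa [hev.self_of_nhds] at this
    have hSn : HasDerivAt (fun t => S (-t)) (-(A * S (-t))) t := by
      have h1 := (hSd (-t)).scomp t (hasDerivAt_neg t)
      rw [neg_one_smul] at h1
      exact h1
    refine (hSn.clm_apply hwd).congr_deriv ?_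
    have h2 : S (-t) (S t (Q n)) = Q n := by
      have := congrArg (fun B : E →L[ℝ] E => B (Q n)) (hSinv t)
      simpa using this
    rw [h2]
    simp

/-! ### Semilinear parabolic systems in a Hilbert space -/

/-- The data of a controlled semilinear parabolic equation `φ' = -A φ - f φ + α` in a Hilbert space:
a symmetric coercive operator `A`, and a nonlinearity `f` that is Lipschitz with constant `L` and
has the symmetric derivative `df`. The constants `δ` and `L` are the only quantitative information
that the error estimates use; the constant of the second order Taylor remainder of `f` may be
arbitrary. -/
structure ParabolicSystem (H : Type*) [NormedAddCommGroup H] [InnerProductSpace ℝ H]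
    (δ L : ℝ) where
  /-- The linear part. -/
  A : H →L[ℝ] H
  /-- The nonlinear part. -/
  f : H → H
  /-- The directional derivative `df u v` of `f` at `u` in direction `v`. -/
  df : H → H → H
  A_symm : ∀ u v, ⟪A u, v⟫_ℝ = ⟪A v, u⟫_ℝ
  A_coercive : ∀ u, δ * ‖u‖ ^ 2 ≤ ⟪A u, u⟫_ℝ
  f_lipschitz : ∀ u v, ‖f u - f v‖ ≤ L * ‖u - v‖
  df_symm : ∀ u v w, ⟪df u v, w⟫_ℝ = ⟪df u w, v⟫_ℝ
  df_bound : ∀ u v, ‖df u v‖ ≤ L * ‖v‖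
  df_continuous : Continuous fun z : H × H => df z.1 z.2
  f_taylor : ∃ R, ∀ u h, ‖f (u + h) - f u - df u h‖ ≤ R * ‖h‖ ^ 2

namespace ParabolicSystem

variable {H : Type*} [NormedAddCommGroup H] [InnerProductSpace ℝ H] {δ L : ℝ}
  (S : ParabolicSystem H δ L)

theorem A_nonneg (hδ : 0 < δ) (u : H) : 0 ≤ ⟪S.A u, u⟫_ℝ :=
  le_trans (by positivity) (S.A_coercive u)

theorem f_continuous : Continuous S.f := by
  rw [Metric.continuous_iff]
  intro u ε hε
  refine ⟨ε / (|L| + 1), by positivity, fun v hv => ?_⟩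
  rw [dist_eq_norm] at hv ⊢
  have h1 := S.f_lipschitz v u
  rw [lt_div_iff₀ (by positivity)] at hv
  nlinarith [le_abs_self L, norm_nonneg (v - u)]

theorem df_smul (c : ℝ) (u v : H) : S.df u (c • v) = c • S.df u v := by
  refine ext_inner_right ℝ fun w => ?_
  rw [S.df_symm, real_inner_smul_right, S.df_symm u w v, real_inner_smul_left]

/-- The Cauchy–Schwarz inequality for the energy form, with a weight `θ`. -/
theorem two_mul_abs_A_le (hδ : 0 < δ) {θ : ℝ} (hθ : 0 < θ) (u v : H) :
    2 * |⟪S.A u, v⟫_ℝ| ≤ θ * ⟪S.A u, u⟫_ℝ + θ⁻¹ * ⟪S.A v, v⟫_ℝ := by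
  have h1 := S.A_nonneg hδ (θ • u - v)
  have h2 := S.A_nonneg hδ (θ • u + v)
  simp only [map_sub, map_add, map_smul, inner_sub_left, inner_sub_right, inner_add_left,
    inner_add_right, real_inner_smul_left, real_inner_smul_right, S.A_symm v u] at h1 h2
  have h3 : θ * (2 * |⟪S.A u, v⟫_ℝ|) ≤ θ * (θ * ⟪S.A u, u⟫_ℝ + θ⁻¹ * ⟪S.A v, v⟫_ℝ) := by
    rw [mul_add, mul_inv_cancel_left₀ hθ.ne']
    rcases abs_cases ⟪S.A u, v⟫_ℝ with ⟨h, _⟩ | ⟨h, _⟩ <;> rw [h] <;> nlinarith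
  exact le_of_mul_le_mul_left h3 hθ

/-- The velocity of the piecewise affine interpolant of an Euler state. -/
def velocity (α φ : ℕ → H) (n : ℕ) : H := -S.A (φ n) - S.f (φ n) + α n

/-- The forward Euler scheme with time step `τ`. -/
def IsEuler (τ : ℝ) (N : ℕ) (α φ : ℕ → H) : Prop :=
  ∀ n < N, φ (n + 1) = φ n + τ • S.velocity α φ n

theorem hasDerivAt_affine (u v : H) (s t : ℝ) :
    HasDerivAt (fun x : ℝ => u + (x - s) • v) v t := by
  simpa using (((hasDerivAt_id t).sub_const s).smul_const v).const_add u

/-- A bound for the displacement within one Euler step, in the energy form. -/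
theorem A_smul_le (hδ : 0 < δ) {v : H} {G τ c : ℝ} (hv : ⟪S.A v, v⟫_ℝ ≤ G) (h0 : 0 ≤ c)
    (hc : c ≤ τ) : ⟪S.A (c • v), c • v⟫_ℝ ≤ G * τ ^ 2 := by
  rw [map_smul, real_inner_smul_left, real_inner_smul_right]
  have h1 := S.A_nonneg hδ v
  have h2 : c * c ≤ τ ^ 2 := by nlinarith
  calc c * (c * ⟪S.A v, v⟫_ℝ) = (c * c) * ⟪S.A v, v⟫_ℝ := by ring
    _ ≤ τ ^ 2 * G := mul_le_mul h2 hv h1 (sq_nonneg τ)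
    _ = G * τ ^ 2 := by ring

theorem norm_smul_le (hδ : 0 < δ) {v : H} {C τ c : ℝ} (hv : ⟪S.A v, v⟫_ℝ ≤ δ * C ^ 2)
    (h0 : 0 ≤ c) (hc : c ≤ τ) : ‖c • v‖ ^ 2 ≤ C ^ 2 * τ ^ 2 := by
  have h1 := (S.A_coercive (c • v)).trans (S.A_smul_le hδ hv h0 hc)
  rw [mul_assoc] at h1
  exact le_of_mul_le_mul_left h1 hδ

/-- On one time step the distance of the solution of `y' = -A y - f (φ n) + α n` to the Euler
interpolant grows at most at the rate given by the displacement of the interpolant. -/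
theorem linear_step_error (hδ : 0 < δ) {y : ℝ → H} (hyc : Continuous y) {G τ s t : ℝ}
    (hst : s ≤ t) (htτ : t ≤ s + τ) (hG : 0 ≤ G) {u q : H}
    (hy : ∀ x ∈ Set.Ioo s t, HasDerivAt y (-S.A (y x) + q) x)
    (hv : ⟪S.A (-S.A u + q), -S.A u + q⟫_ℝ ≤ G) :
    ‖y t - (u + (t - s) • (-S.A u + q))‖ ^ 2 ≤ ‖y s - u‖ ^ 2 + (t - s) * (G / 2 * τ ^ 2) := by
  set v := -S.A u + q with hvdef
  have hc : Continuous fun x => y x - (u + (x - s) • v) := by fun_prop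
  have hd : ∀ x ∈ Set.Ioo s t, HasDerivAt (fun x => y x - (u + (x - s) • v))
      ((-S.A (y x) + q) - v) x := fun x hx => (hy x hx).sub (hasDerivAt_affine u v s x)
  have key := gronwall_of_hasDerivAt_Ioo (E := fun x => ‖y x - (u + (x - s) • v)‖ ^ 2)
    (a := 0) (b := G / 2 * τ ^ 2) hst le_rfl (by positivity) (by fun_prop)
    (fun x hx => (hd x hx).norm_sq) ?_
  · simpa using key
  · intro x hx
    set e := y x - (u + (x - s) • v) with he
    have h1 : (-S.A (y x) + q) - v = -S.A e - S.A ((x - s) • v) := by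
      rw [he, hvdef]
      simp only [map_sub, map_add, map_smul]
      abel
    have h2 := S.two_mul_abs_A_le hδ (θ := 1 / 2) (by norm_num) ((x - s) • v) e
    have h3 := S.A_smul_le hδ hv (sub_nonneg.2 hx.1.le) (show x - s ≤ τ by linarith [hx.2])
    have h4 := neg_abs_le ⟪S.A ((x - s) • v), e⟫_ℝ
    rw [h1, real_inner_comm, inner_sub_left, inner_neg_left]
    rw [show (1 / 2 : ℝ)⁻¹ = 2 by norm_num] at h2
    linarith

/-- The distance of the Euler state to the solution of the linear equation that is driven by the
Euler values of the nonlinearity and the control. -/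
theorem linear_flow_error (hδ : 0 < δ) {y : ℝ → H} (hyc : Continuous y) {G τ : ℝ} (hτ : 0 < τ)
    (hG : 0 ≤ G) {N : ℕ} {α φ : ℕ → H} (hE : S.IsEuler τ N α φ) (hy0 : y 0 = φ 0)
    (hy : ∀ n < N, ∀ t ∈ Set.Ioo (n * τ) ((n + 1) * τ),
      HasDerivAt y (-S.A (y t) + (α n - S.f (φ n))) t)
    (hv : ∀ n < N, ⟪S.A (S.velocity α φ n), S.velocity α φ n⟫_ℝ ≤ G) {n : ℕ} (hn : n ≤ N) :
    ‖y (n * τ) - φ n‖ ^ 2 ≤ n * τ * (G / 2 * τ ^ 2) ∧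
      (n < N → ∀ t ∈ Set.Icc (n * τ) ((n + 1) * τ),
        ‖y t - (φ n + (t - n * τ) • S.velocity α φ n)‖ ^ 2 ≤ t * (G / 2 * τ ^ 2)) := by
  have hvel : ∀ n, S.velocity α φ n = -S.A (φ n) + (α n - S.f (φ n)) := by
    intro n
    rw [velocity]
    abel
  have step : ∀ n < N, ‖y (n * τ) - φ n‖ ^ 2 ≤ n * τ * (G / 2 * τ ^ 2) →
      ∀ t ∈ Set.Icc (n * τ) ((n + 1) * τ),
        ‖y t - (φ n + (t - n * τ) • S.velocity α φ n)‖ ^ 2 ≤ t * (G / 2 * τ ^ 2) := by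
    intro n hn hind t ht
    have h := S.linear_step_error hδ hyc (τ := τ) (u := φ n) (q := α n - S.f (φ n)) ht.1
      (by linarith [ht.2]) hG (fun x hx => hy n hn x ⟨hx.1, hx.2.trans_le ht.2⟩)
      (by rw [← hvel]; exact hv n hn)
    rw [← hvel] at h
    refine h.trans ?_
    linarith
  suffices hmain : ‖y (n * τ) - φ n‖ ^ 2 ≤ n * τ * (G / 2 * τ ^ 2) from
    ⟨hmain, fun hn' => step n hn' hmain⟩
  induction n with
  | zero => simp [hy0]
  | succ n ih =>
    have h := step n hn (ih (by omega)) ((n + 1) * τ) ⟨by nlinarith, le_rfl⟩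
    rw [hE n hn]
    have h2 : ((n : ℝ) + 1) * τ - n * τ = τ := by ring
    rw [h2] at h
    push_cast
    exact h

end ParabolicSystem

/-! ### From the Euler scheme to the time-continuous equation -/

theorem integral_le_sum_of_le_Ioo {g : ℝ → ℝ} {τ : ℝ} (hτ : 0 < τ) {N : ℕ} {c : ℕ → ℝ}
    (hg : ∀ a b, IntervalIntegrable g MeasureTheory.volume a b)
    (h : ∀ n < N, ∀ t ∈ Set.Ioo (n * τ) ((n + 1) * τ), g t ≤ c n) :
    ∫ t in (0 : ℝ)..N * τ, g t ≤ τ * ∑ n ∈ Finset.range N, c n := by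
  have h1 := intervalIntegral.sum_integral_adjacent_intervals (f := g)
    (a := fun n : ℕ => (n : ℝ) * τ) (n := N) fun k _ => hg _ _
  simp only [Nat.cast_zero, zero_mul] at h1
  rw [← h1, Finset.mul_sum]
  refine Finset.sum_le_sum fun n hn => ?_
  have h2 := intervalIntegral.integral_mono_on_of_le_Ioo
    (μ := MeasureTheory.volume) (f := g) (g := fun _ => c n)
    (a := (n : ℝ) * τ) (b := ((n + 1 : ℕ) : ℝ) * τ) (by push_cast; nlinarith) (hg _ _)
    intervalIntegrable_const
    (fun t ht => h n (Finset.mem_range.1 hn) t (by push_cast at ht; exact ht))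
  refine h2.trans (le_of_eq ?_)
  rw [intervalIntegral.integral_const, smul_eq_mul]
  push_cast
  ring

/-- Changing the final state by `e` changes the final cost by `O(‖e‖)`. -/
theorem sq_norm_sub_le_of_norm_sub_le {H : Type*} [NormedAddCommGroup H] {x y p : H}
    {K R c τ T : ℝ} (hK : 0 < K) (hR : K * ‖x - p‖ ^ 2 ≤ R) (hc : 0 ≤ c) (hτ : 0 ≤ τ)
    (hτT : τ ≤ T) (h : ‖y - x‖ ≤ c * τ) :
    K * ‖y - p‖ ^ 2 ≤ K * ‖x - p‖ ^ 2 + (c * (K + R) + K * c ^ 2 * T) * τ := by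
  have h1 : ‖y - p‖ ≤ ‖x - p‖ + c * τ := by
    have := norm_add_le (y - x) (x - p)
    rw [sub_add_sub_cancel] at this
    linarith
  have h2 : ‖y - p‖ ^ 2 ≤ (‖x - p‖ + c * τ) ^ 2 := pow_le_pow_left₀ (norm_nonneg _) h1 2
  have h3 : 2 * ‖x - p‖ ≤ 1 + ‖x - p‖ ^ 2 := by nlinarith [sq_nonneg (‖x - p‖ - 1)]
  have h4 : 0 ≤ c * τ := mul_nonneg hc hτ
  have h5 : K * (2 * ‖x - p‖) ≤ K + R := by nlinarith
  have h6 : K * c ^ 2 * (τ * τ) ≤ K * c ^ 2 * (T * τ) :=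
    mul_le_mul_of_nonneg_left (mul_le_mul_of_nonneg_right hτT hτ) (by positivity)
  have h7 := mul_le_mul_of_nonneg_left h5 h4
  have h8 := mul_le_mul_of_nonneg_left h2 hK.le
  nlinarith

namespace ParabolicSystem

variable {H : Type*} [NormedAddCommGroup H] [InnerProductSpace ℝ H] {δ L : ℝ}
  (S : ParabolicSystem H δ L)

/-- `φ` solves the integrated equation on `[0, T]` with control `α`. -/
def IsState (T : ℝ) (α φ : ℝ → H) : Prop :=
  ∀ t ∈ Set.Icc 0 T, φ t = φ 0 + ∫ s in (0 : ℝ)..t, (-S.A (φ s) - S.f (φ s) + α s)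

/-- An Euler pair with moderate increments is shadowed by a pair for the time-continuous equation
whose cost is larger by `O(τ)` at most. The state `y` solves the linear equation driven by the Euler
values of the nonlinearity, and the control makes up for the error in the nonlinearity. Here `c₁ τ`
bounds the distance of `y` to the Euler interpolant, and `c₂ τ` the distance of the controls. -/
theorem exists_state_cost_le [CompleteSpace H] (hδ : 0 < δ) (hL : 0 ≤ L) {T K C R : ℝ}
    (hT : 0 < T) (hK : 0 < K) {N : ℕ} (hN : 1 ≤ N) {p : H} {α φ : ℕ → H}
    (hE : S.IsEuler (T / N) N α φ)
    (hv : ∀ n < N, ⟪S.A (S.velocity α φ n), S.velocity α φ n⟫_ℝ ≤ δ * C ^ 2)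
    (hR : K * ‖φ N - p‖ ^ 2 + T / N * ∑ n ∈ Finset.range N, ‖α n‖ ^ 2 / 2 ≤ R)
    {c₁ c₂ : ℝ} (hc₁ : c₁ = Real.sqrt (δ * C ^ 2 / 2 * T)) (hc₂ : c₂ = L * (c₁ + |C|)) :
    ∃ β y : ℝ → H, Continuous y ∧ y 0 = φ 0 ∧
      MeasureTheory.MemLp β 2 (MeasureTheory.volume.restrict (Set.Ioc 0 T)) ∧
      S.IsState T β y ∧
      K * ‖y T - p‖ ^ 2 + ∫ t in (0 : ℝ)..T, ‖β t‖ ^ 2 / 2 ≤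
        K * ‖φ N - p‖ ^ 2 + T / N * ∑ n ∈ Finset.range N, ‖α n‖ ^ 2 / 2 +
          ((c₁ * (K + R) + K * c₁ ^ 2 * T) + (c₂ * (T / 2 + R) + c₂ ^ 2 / 2 * T * T)) *
            (T / N) := by
  have hN0 : (0 : ℝ) < N := by exact_mod_cast hN
  set τ := T / N with hτdef
  have hτ : 0 < τ := div_pos hT hN0
  have hNτ : (N : ℝ) * τ = T := mul_div_cancel₀ T hN0.ne'
  have hτT : τ ≤ T := by
    have : (1 : ℝ) ≤ N := by exact_mod_cast hN
    nlinarith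
  have hc₁0 : 0 ≤ c₁ := hc₁ ▸ Real.sqrt_nonneg _
  have hc₁sq : c₁ ^ 2 = δ * C ^ 2 / 2 * T := by
    rw [hc₁, Real.sq_sqrt (by positivity)]
  have hc₂0 : 0 ≤ c₂ := by rw [hc₂]; positivity
  set Q : ℕ → H := fun n => if n < N then α n - S.f (φ n) else 0 with hQ
  set B := ∑ n ∈ Finset.range N, ‖Q n‖ with hB
  have hQB : ∀ n, ‖Q n‖ ≤ B := by
    intro n
    by_cases hn : n < N
    · exact Finset.single_le_sum (f := fun n => ‖Q n‖) (fun _ _ => norm_nonneg _)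
        (Finset.mem_range.2 hn)
    · simp only [hQ, if_neg hn, norm_zero]
      exact Finset.sum_nonneg fun _ _ => norm_nonneg _
  obtain ⟨y, hyc, hy0, hyd⟩ := exists_linear_flow S.A (φ 0) hτ Q hQB
  have hyd' : ∀ n < N, ∀ t ∈ Set.Ioo (n * τ) ((n + 1) * τ),
      HasDerivAt y (-S.A (y t) + (α n - S.f (φ n))) t := by
    intro n hn t ht
    have := hyd n t ht
    simpa only [hQ, if_pos hn] using this
  have herr := fun n (hn : n ≤ N) =>
    S.linear_flow_error hδ hyc hτ (by positivity) hE hy0 hyd' hv hn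
  set β : ℝ → H := fun t => Q ⌊t / τ⌋₊ + S.f (y t) with hβ
  have hfy : Continuous fun t => S.f (y t) := S.f_continuous.comp hyc
  have hβm : MeasureTheory.StronglyMeasurable β :=
    (stronglyMeasurable_step Q τ).add hfy.stronglyMeasurable
  have hβb : ∀ t, ‖β t‖ ≤ B + ‖S.f (y t)‖ := fun t =>
    (norm_add_le _ _).trans (add_le_add (hQB _) le_rfl)
  have hβi : ∀ a b, IntervalIntegrable β MeasureTheory.volume a b := fun a b =>
    IntervalIntegrable.mono_fun' (g := fun t => B + ‖S.f (y t)‖)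
      (Continuous.intervalIntegrable (by fun_prop) a b) hβm.aestronglyMeasurable
      (Filter.Eventually.of_forall hβb)
  have hβi2 : ∀ a b, IntervalIntegrable (fun t => ‖β t‖ ^ 2 / 2) MeasureTheory.volume a b := by
    intro a b
    refine IntervalIntegrable.mono_fun' (g := fun t => (B + ‖S.f (y t)‖) ^ 2 / 2)
      (Continuous.intervalIntegrable (by fun_prop) a b) ?_
      (Filter.Eventually.of_forall fun t => ?_)
    · have h1 : MeasureTheory.StronglyMeasurable fun t => ‖β t‖ ^ 2 / 2 :=
        Continuous.comp_stronglyMeasurable (g := fun x : H => ‖x‖ ^ 2 / 2) (by fun_prop) hβm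
      exact h1.aestronglyMeasurable
    · dsimp only
      rw [Real.norm_of_nonneg (by positivity)]
      have := pow_le_pow_left₀ (norm_nonneg _) (hβb t) 2
      linarith
  -- On the `n`-th step the control is an `O(τ)` perturbation of `α n`.
  have hβstep : ∀ n < N, ∀ t ∈ Set.Ioo (n * τ) ((n + 1) * τ),
      ‖β t‖ ≤ ‖α n‖ + c₂ * τ := by
    intro n hn t ht
    have h0 : 0 ≤ t - n * τ := by linarith [ht.1]
    have h1 : t - n * τ ≤ τ := by linarith [ht.2]
    have h2 := (herr n hn.le).2 hn t ⟨ht.1.le, ht.2.le⟩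
    have h3 := S.norm_smul_le hδ (hv n hn) h0 h1
    have htT : t ≤ T := by
      have h4 : ((n + 1 : ℕ) : ℝ) ≤ N := by exact_mod_cast hn
      push_cast at h4
      rw [← hNτ]
      nlinarith [ht.2]
    have h4 : ‖(t - n * τ) • S.velocity α φ n‖ ≤ |C| * τ := by
      refine abs_le_of_sq_le_sq' ?_ (by positivity) |>.2
      rw [mul_pow, sq_abs]
      exact h3
    have h5 : ‖y t - (φ n + (t - n * τ) • S.velocity α φ n)‖ ≤ c₁ * τ := by
      refine abs_le_of_sq_le_sq' ?_ (by positivity) |>.2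
      rw [mul_pow, hc₁sq]
      have : t * (δ * C ^ 2 / 2 * τ ^ 2) ≤ T * (δ * C ^ 2 / 2 * τ ^ 2) :=
        mul_le_mul_of_nonneg_right htT (by positivity)
      linarith
    have h6 : ‖y t - φ n‖ ≤ (c₁ + |C|) * τ := by
      have h7 : y t - φ n = (y t - (φ n + (t - n * τ) • S.velocity α φ n)) +
        (t - n * τ) • S.velocity α φ n := by abel
      rw [h7]
      refine (norm_add_le _ _).trans ?_
      linarith
    have h8 : β t = α n + (S.f (y t) - S.f (φ n)) := by
      simp only [hβ, hQ]
      rw [floor_div_eq_of_mem_Ioo hτ ht, if_pos hn]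
      abel
    rw [h8]
    refine (norm_add_le _ _).trans (add_le_add le_rfl ?_)
    refine (S.f_lipschitz _ _).trans ?_
    rw [hc₂, mul_assoc]
    exact mul_le_mul_of_nonneg_left h6 hL
  refine ⟨β, y, hyc, hy0, ?_, ?_, ?_⟩
  · obtain ⟨b, hb⟩ := (isCompact_Icc (a := (0 : ℝ)) (b := T)).exists_bound_of_continuousOn
      hfy.continuousOn
    refine MeasureTheory.MemLp.of_bound hβm.aestronglyMeasurable (B + b) ?_
    filter_upwards [MeasureTheory.ae_restrict_mem measurableSet_Ioc] with t ht
    exact (hβb t).trans (add_le_add le_rfl (hb t ⟨ht.1.le, ht.2⟩))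
  · intro t ht
    have hcnt : (Set.range fun n : ℕ => (n : ℝ) * τ).Countable := Set.countable_range _
    have h1 := MeasureTheory.integral_eq_of_hasDerivAt_off_countable (a := 0) (b := t) y
      (fun s => -S.A (y s) - S.f (y s) + β s) hcnt hyc.continuousOn ?_ ?_
    · rw [h1]
      abel
    · rintro x ⟨hx, hx'⟩
      rw [min_eq_left ht.1, max_eq_right ht.1] at hx
      have hx0 : 0 ≤ x / τ := div_nonneg hx.1.le hτ.le
      have hmem : x ∈ Set.Ioo ((⌊x / τ⌋₊ : ℝ) * τ) ((⌊x / τ⌋₊ + 1) * τ) := by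
        refine ⟨lt_of_le_of_ne ?_ fun h => hx' ⟨_, h⟩, ?_⟩
        · exact (le_div_iff₀ hτ).1 (Nat.floor_le hx0)
        · exact (div_lt_iff₀ hτ).1 (Nat.lt_floor_add_one _)
      refine (hyd _ x hmem).congr_deriv ?_
      simp only [hβ]
      abel
    · have h2 : Continuous fun s => -S.A (y s) - S.f (y s) := by fun_prop
      exact (h2.intervalIntegrable 0 t).add (hβi 0 t)
  · have hfin : K * ‖y T - p‖ ^ 2 ≤
        K * ‖φ N - p‖ ^ 2 + (c₁ * (K + R) + K * c₁ ^ 2 * T) * τ := by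
      refine sq_norm_sub_le_of_norm_sub_le hK ?_ hc₁0 hτ.le hτT ?_
      · refine le_trans (le_add_of_nonneg_right ?_) hR
        exact mul_nonneg hτ.le (Finset.sum_nonneg fun _ _ => by positivity)
      · have h1 := (herr N le_rfl).1
        rw [hNτ] at h1
        refine abs_le_of_sq_le_sq' ?_ (by positivity) |>.2
        rw [mul_pow, hc₁sq]
        linarith
    have hrun : ∫ t in (0 : ℝ)..T, ‖β t‖ ^ 2 / 2 ≤
        τ * ∑ n ∈ Finset.range N,
          (‖α n‖ ^ 2 / 2 + (c₂ * τ * (1 / 2 + ‖α n‖ ^ 2 / 2) + c₂ ^ 2 / 2 * T * τ)) := by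
      rw [← hNτ]
      refine integral_le_sum_of_le_Ioo hτ hβi2 fun n hn t ht => ?_
      have h1 := pow_le_pow_left₀ (norm_nonneg _) (hβstep n hn t ht) 2
      have h2 : ‖α n‖ ≤ 1 / 2 + ‖α n‖ ^ 2 / 2 := by nlinarith [sq_nonneg (‖α n‖ - 1)]
      have h3 := mul_le_mul_of_nonneg_left h2 (mul_nonneg hc₂0 hτ.le)
      have h4 : c₂ ^ 2 / 2 * (τ * τ) ≤ c₂ ^ 2 / 2 * (N * τ * τ) :=
        mul_le_mul_of_nonneg_left (mul_le_mul_of_nonneg_right (hNτ.symm ▸ hτT) hτ.le)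
          (by positivity)
      nlinarith
    set s := ∑ n ∈ Finset.range N, ‖α n‖ ^ 2 / 2 with hs
    have hsR : τ * s ≤ R := by
      have : 0 ≤ K * ‖φ N - p‖ ^ 2 := by positivity
      linarith
    have hsum : τ * ∑ n ∈ Finset.range N,
          (‖α n‖ ^ 2 / 2 + (c₂ * τ * (1 / 2 + ‖α n‖ ^ 2 / 2) + c₂ ^ 2 / 2 * T * τ)) =
        τ * s + (c₂ * ((N * τ) / 2 + τ * s) + c₂ ^ 2 / 2 * T * (N * τ)) * τ := by
      rw [Finset.sum_add_distrib, Finset.sum_add_distrib, ← Finset.mul_sum,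
        Finset.sum_add_distrib, ← hs]
      simp only [Finset.sum_const, Finset.card_range, nsmul_eq_mul]
      ring
    rw [hsum, hNτ] at hrun
    have h5 : c₂ * (τ * s) * τ ≤ c₂ * R * τ :=
      mul_le_mul_of_nonneg_right (mul_le_mul_of_nonneg_left hsR hc₂0) hτ.le
    nlinarith

end ParabolicSystem

/-! ### The Euler–Lagrange equation for optimal controls -/

/-- A linear function with a quadratic error term that is nonnegative near `0` vanishes. -/
theorem eq_zero_of_forall_nonneg_add_sq {a c : ℝ} (h : ∀ ε : ℝ, |ε| ≤ 1 → 0 ≤ ε * a + ε ^ 2 * c) :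
    a = 0 := by
  by_contra ha
  have hd : 0 < |a| + |c| + 1 := by positivity
  have h1 := h (-a / (|a| + |c| + 1)) (by
    rw [abs_div, abs_neg, abs_of_pos hd, div_le_one hd]
    linarith [abs_nonneg c])
  have h2 : -a / (|a| + |c| + 1) * a + (-a / (|a| + |c| + 1)) ^ 2 * c =
      -(a ^ 2 * (|a| + |c| + 1 - c)) / (|a| + |c| + 1) ^ 2 := by
    field_simp
    ring
  have h3 : 0 < a ^ 2 * (|a| + |c| + 1 - c) :=
    mul_pos (by positivity) (by linarith [le_abs_self c, abs_pos.2 ha])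
  rw [h2, neg_div] at h1
  have h4 : 0 < a ^ 2 * (|a| + |c| + 1 - c) / (|a| + |c| + 1) ^ 2 := div_pos h3 (by positivity)
  linarith

namespace ParabolicSystem

variable {H : Type*} [NormedAddCommGroup H] [InnerProductSpace ℝ H] {δ L : ℝ}
  (S : ParabolicSystem H δ L)

/-- The pair `(α, φ)` minimizes the cost among all continuous pairs with the same initial value. -/
def IsOptimal (T K : ℝ) (p : H) (α φ : ℝ → H) : Prop :=
  ∀ β ψ : ℝ → H, Continuous β → Continuous ψ → ψ 0 = φ 0 → S.IsState T β ψ →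
    K * ‖φ T - p‖ ^ 2 + ∫ t in (0 : ℝ)..T, ‖α t‖ ^ 2 / 2 ≤
      K * ‖ψ T - p‖ ^ 2 + ∫ t in (0 : ℝ)..T, ‖β t‖ ^ 2 / 2

/-- The right hand side of the equation for the optimal control. -/
def adjointRHS (α φ : ℝ → H) (t : ℝ) : H := S.A (α t) + S.df (φ t) (α t)

theorem continuous_df {α φ : ℝ → H} (hα : Continuous α) (hφ : Continuous φ) :
    Continuous fun t => S.df (φ t) (α t) :=
  S.df_continuous.comp (hφ.prodMk hα)

theorem continuous_adjointRHS {α φ : ℝ → H} (hα : Continuous α) (hφ : Continuous φ) :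
    Continuous (S.adjointRHS α φ) :=
  (S.A.continuous.comp hα).add (S.continuous_df hα hφ)

/-- The first variation of the cost vanishes. Since the control acts on the whole space, every
`C¹` curve is a state, and it suffices to vary the state in a straight line. -/
theorem first_variation [CompleteSpace H] {T K : ℝ} (hT : 0 < T) {p : H} {α φ : ℝ → H}
    (hα : Continuous α) (hφ : Continuous φ) (hst : S.IsState T α φ)
    (hopt : S.IsOptimal T K p α φ) {η ψ : ℝ → H} (hη : Continuous η) (hψ : Continuous ψ)
    (hψη : ∀ t, ψ t = ∫ s in (0 : ℝ)..t, η s) :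
    2 * K * ⟪φ T - p, ψ T⟫_ℝ +
      ∫ t in (0 : ℝ)..T, ⟪α t, η t + S.A (ψ t) + S.df (φ t) (ψ t)⟫_ℝ = 0 := by
  obtain ⟨R, hR⟩ := S.f_taylor
  set ξ : ℝ → H := fun t => η t + S.A (ψ t) + S.df (φ t) (ψ t) with hξ
  have hξc : Continuous ξ := (hη.add (S.A.continuous.comp hψ)).add (S.continuous_df hψ hφ)
  set c : ℝ → ℝ := fun t => ‖α t‖ * (R * ‖ψ t‖ ^ 2) + (‖ξ t‖ + R * ‖ψ t‖ ^ 2) ^ 2 / 2 with hc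
  have hcc : Continuous c := by fun_prop
  have hψ0 : ψ 0 = 0 := by rw [hψη]; simp
  refine eq_zero_of_forall_nonneg_add_sq
    (c := K * ‖ψ T‖ ^ 2 + ∫ t in (0 : ℝ)..T, c t) fun ε hε => ?_
  set φε : ℝ → H := fun t => φ t + ε • ψ t with hφε
  set ρ : ℝ → H := fun t => S.f (φ t + ε • ψ t) - S.f (φ t) - S.df (φ t) (ε • ψ t) with hρ
  set αε : ℝ → H := fun t => α t + (ε • ξ t + ρ t) with hαε
  have hφεc : Continuous φε := by fun_prop
  have hρc : Continuous ρ :=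
    ((S.f_continuous.comp hφεc).sub (S.f_continuous.comp hφ)).sub
      (S.continuous_df (hψ.const_smul ε) hφ)
  have hαεc : Continuous αε := by fun_prop
  have hεsq : ε ^ 2 ≤ 1 := (sq_le_one_iff_abs_le_one ε).2 hε
  -- The remainder of the nonlinearity is of second order in `ε`, uniformly in time.
  have hρb : ∀ t, ‖ρ t‖ ≤ ε ^ 2 * (R * ‖ψ t‖ ^ 2) := by
    intro t
    refine (hR (φ t) (ε • ψ t)).trans (le_of_eq ?_)
    rw [norm_smul, mul_pow, Real.norm_eq_abs, sq_abs]
    ring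
  have hRψ : ∀ t, 0 ≤ R * ‖ψ t‖ ^ 2 := fun t => (norm_nonneg _).trans (hR 0 (ψ t))
  have hstε : S.IsState T αε φε := by
    intro t ht
    have hfc := S.f_continuous
    have h1 : ∀ s, -S.A (φε s) - S.f (φε s) + αε s =
        (-S.A (φ s) - S.f (φ s) + α s) + ε • η s := by
      intro s
      simp only [hφε, hαε, hρ, hξ, map_add, map_smul, S.df_smul, smul_add]
      abel
    simp only [h1]
    rw [intervalIntegral.integral_add
      (Continuous.intervalIntegrable (by fun_prop) _ _)
      (Continuous.intervalIntegrable (by fun_prop) _ _), intervalIntegral.integral_smul,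
      ← hψη]
    simp only [hφε, hψ0, smul_zero, add_zero]
    rw [← add_assoc, ← hst t ht]
  have hle := hopt αε φε hαεc hφεc (by simp [hφε, hψ0]) hstε
  have hpt : ∀ t, ‖αε t‖ ^ 2 / 2 ≤ ‖α t‖ ^ 2 / 2 + (ε * ⟪α t, ξ t⟫_ℝ + ε ^ 2 * c t) := by
    intro t
    have h1 : ‖ε • ξ t + ρ t‖ ≤ |ε| * (‖ξ t‖ + R * ‖ψ t‖ ^ 2) := by
      refine (norm_add_le _ _).trans ?_
      rw [norm_smul, Real.norm_eq_abs, mul_add]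
      refine add_le_add le_rfl ((hρb t).trans ?_)
      refine mul_le_mul_of_nonneg_right ?_ (hRψ t)
      rw [← sq_abs]
      nlinarith [abs_nonneg ε]
    have h2 : ‖ε • ξ t + ρ t‖ ^ 2 ≤ ε ^ 2 * (‖ξ t‖ + R * ‖ψ t‖ ^ 2) ^ 2 := by
      have := pow_le_pow_left₀ (norm_nonneg _) h1 2
      rwa [mul_pow, sq_abs] at this
    have h3 : ⟪α t, ρ t⟫_ℝ ≤ ‖α t‖ * (ε ^ 2 * (R * ‖ψ t‖ ^ 2)) :=
      (real_inner_le_norm _ _).trans (mul_le_mul_of_nonneg_left (hρb t) (norm_nonneg _))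
    simp only [hαε]
    rw [norm_add_sq_real, inner_add_right, real_inner_smul_right]
    simp only [hc]
    nlinarith
  have hint := intervalIntegral.integral_mono_on (μ := MeasureTheory.volume) hT.le
    (Continuous.intervalIntegrable (by fun_prop) 0 T)
    (Continuous.intervalIntegrable (by fun_prop) 0 T) fun t _ => hpt t
  rw [intervalIntegral.integral_add (Continuous.intervalIntegrable (by fun_prop) _ _)
      (Continuous.intervalIntegrable (by fun_prop) _ _),
    intervalIntegral.integral_add (Continuous.intervalIntegrable (by fun_prop) _ _)
      (Continuous.intervalIntegrable (by fun_prop) _ _),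
    intervalIntegral.integral_const_mul, intervalIntegral.integral_const_mul] at hint
  have hend : ‖φε T - p‖ ^ 2 = ‖φ T - p‖ ^ 2 + 2 * (ε * ⟪φ T - p, ψ T⟫_ℝ) +
      ε ^ 2 * ‖ψ T‖ ^ 2 := by
    have h1 : φε T - p = (φ T - p) + ε • ψ T := by
      simp only [hφε]
      abel
    rw [h1, norm_add_sq_real, real_inner_smul_right, norm_smul, mul_pow, Real.norm_eq_abs, sq_abs]
  rw [hend] at hle
  nlinarith

/-- The optimal control satisfies a linear backward equation, with a terminal value given by the
final cost. This is the du Bois-Reymond argument: after an integration by parts the first variation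
pairs the derivative of the variation with a fixed curve, which must then vanish. -/
theorem euler_lagrange [CompleteSpace H] {T K : ℝ} (hT : 0 < T) {p : H} {α φ : ℝ → H}
    (hα : Continuous α) (hφ : Continuous φ) (hst : S.IsState T α φ)
    (hopt : S.IsOptimal T K p α φ) :
    α T = -((2 * K) • (φ T - p)) ∧ ∀ s ∈ Set.Icc 0 T, ∀ t ∈ Set.Icc 0 T,
      α t = α s + ∫ r in s..t, S.adjointRHS α φ r := by
  set m := S.adjointRHS α φ with hm
  have hmc : Continuous m := S.continuous_adjointRHS hα hφ
  set Γ : ℝ → H := fun t => ∫ s in (0 : ℝ)..t, m s with hΓ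
  have hΓd : ∀ t, HasDerivAt Γ (m t) t := fun t => hmc.integral_hasStrictDerivAt 0 t |>.hasDerivAt
  have hΓc : Continuous Γ := continuous_iff_continuousAt.2 fun t => (hΓd t).continuousAt
  set κ : H := (2 * K) • (φ T - p) + Γ T with hκ
  set η : ℝ → H := fun t => α t - Γ t + κ with hη
  have hηc : Continuous η := by fun_prop
  set ψ : ℝ → H := fun t => ∫ s in (0 : ℝ)..t, η s with hψ
  have hψd : ∀ t, HasDerivAt ψ (η t) t := fun t => hηc.integral_hasStrictDerivAt 0 t |>.hasDerivAt
  have hψc : Continuous ψ := continuous_iff_continuousAt.2 fun t => (hψd t).continuousAt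
  have hfv := S.first_variation hT hα hφ hst hopt hηc hψc fun t => rfl
  have hsymm : ∀ t, ⟪α t, η t + S.A (ψ t) + S.df (φ t) (ψ t)⟫_ℝ =
      ⟪α t, η t⟫_ℝ + ⟪m t, ψ t⟫_ℝ := by
    intro t
    rw [hm, adjointRHS, inner_add_right, inner_add_right, inner_add_left,
      real_inner_comm (S.A (ψ t)) (α t), S.A_symm, real_inner_comm (S.df (φ t) (ψ t)) (α t),
      S.df_symm]
    ring
  have hparts : ∫ t in (0 : ℝ)..T, ⟪m t, ψ t⟫_ℝ =
      ⟪Γ T, ψ T⟫_ℝ - ∫ t in (0 : ℝ)..T, ⟪Γ t, η t⟫_ℝ := by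
    have h1 := intervalIntegral.integral_eq_sub_of_hasDerivAt (a := 0) (b := T)
      (f := fun t => ⟪Γ t, ψ t⟫_ℝ) (fun t _ => (hΓd t).inner ℝ (hψd t))
      (Continuous.intervalIntegrable (by fun_prop) _ _)
    rw [intervalIntegral.integral_add (Continuous.intervalIntegrable (by fun_prop) _ _)
      (Continuous.intervalIntegrable (by fun_prop) _ _)] at h1
    have h2 : ψ 0 = 0 := by simp [hψ]
    rw [h2, inner_zero_right, sub_zero] at h1
    linarith
  have hκψ : ⟪κ, ψ T⟫_ℝ = ∫ t in (0 : ℝ)..T, ⟪κ, η t⟫_ℝ := by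
    have := (innerSL ℝ κ).intervalIntegral_comp_comm (μ := MeasureTheory.volume)
      (hηc.intervalIntegrable 0 T)
    simpa using this.symm
  have hzero : ∫ t in (0 : ℝ)..T, ‖η t‖ ^ 2 = 0 := by
    have h1 : ∀ t, ‖η t‖ ^ 2 = (⟪α t, η t⟫_ℝ - ⟪Γ t, η t⟫_ℝ) + ⟪κ, η t⟫_ℝ := by
      intro t
      rw [← real_inner_self_eq_norm_sq, ← inner_sub_left, ← inner_add_left]
    simp only [h1]
    rw [intervalIntegral.integral_add (Continuous.intervalIntegrable (by fun_prop) _ _)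
      (Continuous.intervalIntegrable (by fun_prop) _ _),
      intervalIntegral.integral_sub (Continuous.intervalIntegrable (by fun_prop) _ _)
      (Continuous.intervalIntegrable (by fun_prop) _ _), ← hκψ]
    simp only [hsymm] at hfv
    rw [intervalIntegral.integral_add (Continuous.intervalIntegrable (by fun_prop) _ _)
      (Continuous.intervalIntegrable (by fun_prop) _ _), hparts] at hfv
    rw [hκ, inner_add_left, real_inner_smul_left]
    linarith
  -- Testing with `η` itself shows that `η` vanishes.
  have hη0 : ∀ t ∈ Set.Icc 0 T, α t = Γ t - κ := by
    intro t ht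
    have h1 : ‖η t‖ ^ 2 = 0 := by
      by_contra hne
      have h2 := intervalIntegral.integral_pos hT
        (f := fun t => ‖η t‖ ^ 2) (Continuous.continuousOn (by fun_prop))
        (fun x _ => by positivity) ⟨t, ht, lt_of_le_of_ne (by positivity) (Ne.symm hne)⟩
      linarith
    have h2 : η t = 0 := by simpa using h1
    simp only [hη] at h2
    rw [eq_sub_iff_add_eq, ← sub_eq_zero, ← h2]
    abel
  refine ⟨?_, fun s hs t ht => ?_⟩
  · rw [hη0 T ⟨hT.le, le_rfl⟩, hκ]
    abel
  · rw [hη0 t ht, hη0 s hs]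
    have h1 : ∫ r in s..t, m r = Γ t - Γ s := by
      simp only [hΓ]
      rw [intervalIntegral.integral_interval_sub_left (hmc.intervalIntegrable _ _)
        (hmc.intervalIntegrable _ _)]
    rw [h1]
    abel

end ParabolicSystem

/-! ### From the time-continuous equation to the Euler scheme -/

theorem sum_integral_steps {g : ℝ → ℝ} (hg : Continuous g) (τ : ℝ) (N : ℕ) :
    ∑ n ∈ Finset.range N, ∫ t in (n : ℝ) * τ..((n : ℝ) + 1) * τ, g t =
      ∫ t in (0 : ℝ)..N * τ, g t := by
  have h1 := intervalIntegral.sum_integral_adjacent_intervals (f := g)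
    (μ := MeasureTheory.volume)
    (a := fun n : ℕ => (n : ℝ) * τ) (n := N) fun k _ => hg.intervalIntegrable _ _
  simp only [Nat.cast_zero, zero_mul, Nat.cast_add, Nat.cast_one] at h1
  exact h1

theorem integral_nonneg_mono_right {g : ℝ → ℝ} (hg : Continuous g) (h0 : ∀ t, 0 ≤ g t)
    {a b c : ℝ} (hab : a ≤ b) (hbc : b ≤ c) : ∫ t in a..b, g t ≤ ∫ t in a..c, g t :=
  intervalIntegral.integral_mono_interval le_rfl hab hbc (Filter.Eventually.of_forall h0)
    (hg.intervalIntegrable _ _)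

/-- A discrete Grönwall inequality. -/
theorem discrete_gronwall {E b : ℕ → ℝ} {a τ : ℝ} (ha : 0 ≤ a) (hτ : 0 ≤ τ) (hb : ∀ n, 0 ≤ b n)
    (h0 : E 0 = 0) {N : ℕ} (h : ∀ n < N, E (n + 1) ≤ Real.exp (a * τ) * (E n + τ * b n)) :
    ∀ n ≤ N, E n ≤ Real.exp (a * (n * τ)) * (τ * ∑ k ∈ Finset.range n, b k) := by
  intro n
  induction n with
  | zero => simp [h0]
  | succ n ih =>
    intro hn
    have h1 := ih (by omega)
    have h2 : τ * b n ≤ Real.exp (a * (n * τ)) * (τ * b n) :=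
      le_mul_of_one_le_left (mul_nonneg hτ (hb n)) (Real.one_le_exp (by positivity))
    have h3 : Real.exp (a * ((n + 1 : ℕ) * τ)) =
        Real.exp (a * τ) * Real.exp (a * (n * τ)) := by
      rw [← Real.exp_add]
      congr 1
      push_cast
      ring
    rw [h3, mul_assoc, Finset.sum_range_succ]
    refine (h n (by omega)).trans (mul_le_mul_of_nonneg_left ?_ (Real.exp_pos _).le)
    linarith

namespace ParabolicSystem

variable {H : Type*} [NormedAddCommGroup H] [InnerProductSpace ℝ H] {δ L : ℝ}
  (S : ParabolicSystem H δ L)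

theorem hasDerivAt_of_isState [CompleteSpace H] {T : ℝ} {α φ : ℝ → H} (hα : Continuous α)
    (hφ : Continuous φ) (hst : S.IsState T α φ) {t : ℝ} (ht : t ∈ Set.Ioo 0 T) :
    HasDerivAt φ (-S.A (φ t) - S.f (φ t) + α t) t := by
  have hf := S.f_continuous
  have hc : Continuous fun s => -S.A (φ s) - S.f (φ s) + α s := by fun_prop
  refine ((hc.integral_hasStrictDerivAt 0 t).hasDerivAt.const_add (φ 0)).congr_of_eventuallyEq ?_
  filter_upwards [isOpen_Ioo.mem_nhds ht] with s hs
  exact hst s ⟨hs.1.le, hs.2.le⟩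

theorem abs_df_le (u v : H) : |⟪S.df u v, v⟫_ℝ| ≤ L * ‖v‖ ^ 2 := by
  refine (abs_real_inner_le_norm _ _).trans ?_
  have := mul_le_mul_of_nonneg_right (S.df_bound u v) (norm_nonneg v)
  linarith

section AdjointEquation

variable {T : ℝ} {α φ : ℝ → H}

/-- The energy identity of the equation for the optimal control. -/
theorem norm_sq_sub_norm_sq [CompleteSpace H] (hα : Continuous α) (hφ : Continuous φ)
    (hadj : ∀ s ∈ Set.Icc 0 T, ∀ t ∈ Set.Icc 0 T, α t = α s + ∫ r in s..t, S.adjointRHS α φ r)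
    {s t : ℝ} (hs : 0 ≤ s) (hst : s ≤ t) (ht : t ≤ T) :
    ‖α t‖ ^ 2 - ‖α s‖ ^ 2 = 2 * (∫ r in s..t, ⟪S.A (α r), α r⟫_ℝ) +
      2 * ∫ r in s..t, ⟪S.df (φ r) (α r), α r⟫_ℝ := by
  have hmc := S.continuous_adjointRHS hα hφ
  have hdc := S.continuous_df hα hφ
  set a : ℝ → H := fun t => α s + ∫ r in s..t, S.adjointRHS α φ r with ha
  have had : ∀ t, HasDerivAt a (S.adjointRHS α φ t) t := fun t =>
    (hmc.integral_hasStrictDerivAt s t).hasDerivAt.const_add (α s)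
  have hac : Continuous a := continuous_iff_continuousAt.2 fun t => (had t).continuousAt
  have haα : ∀ r ∈ Set.Icc s t, α r = a r := fun r hr =>
    hadj s ⟨hs, hst.trans ht⟩ r ⟨hs.trans hr.1, hr.2.trans ht⟩
  have h1 := intervalIntegral.integral_eq_sub_of_hasDerivAt (a := s) (b := t)
    (fun r _ => (had r).norm_sq) (Continuous.intervalIntegrable (by fun_prop) _ _)
  rw [haα t ⟨hst, le_rfl⟩, haα s ⟨le_rfl, hst⟩, ← h1, ← intervalIntegral.integral_const_mul,
    ← intervalIntegral.integral_const_mul, ← intervalIntegral.integral_add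
      (Continuous.intervalIntegrable (by fun_prop) _ _)
      (Continuous.intervalIntegrable (by fun_prop) _ _)]
  refine intervalIntegral.integral_congr fun r hr => ?_
  rw [Set.uIcc_of_le hst] at hr
  rw [← haα r hr, adjointRHS, real_inner_comm, inner_add_left]
  ring

theorem abs_integral_df_le (hα : Continuous α) {s t : ℝ} (hst : s ≤ t) :
    |∫ r in s..t, ⟪S.df (φ r) (α r), α r⟫_ℝ| ≤ L * ∫ r in s..t, ‖α r‖ ^ 2 := by
  rw [← intervalIntegral.integral_const_mul]
  exact intervalIntegral.norm_integral_le_of_norm_le (g := fun r => L * ‖α r‖ ^ 2)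
    (f := fun r => ⟪S.df (φ r) (α r), α r⟫_ℝ) hst
    (Filter.Eventually.of_forall fun r _ => S.abs_df_le (φ r) (α r))
    (Continuous.intervalIntegrable (by fun_prop) _ _)

/-- The optimal control is bounded in the energy space, in the mean square over time. -/
theorem integral_A_le [CompleteSpace H] (hα : Continuous α) (hφ : Continuous φ) (hT : 0 ≤ T)
    (hadj : ∀ s ∈ Set.Icc 0 T, ∀ t ∈ Set.Icc 0 T, α t = α s + ∫ r in s..t, S.adjointRHS α φ r) :
    ∫ r in (0 : ℝ)..T, ⟪S.A (α r), α r⟫_ℝ ≤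
      ‖α T‖ ^ 2 / 2 + L * ∫ r in (0 : ℝ)..T, ‖α r‖ ^ 2 := by
  have h1 := S.norm_sq_sub_norm_sq hα hφ hadj le_rfl hT le_rfl
  have h2 := S.abs_integral_df_le (φ := φ) hα hT
  have h3 := neg_abs_le (∫ r in (0 : ℝ)..T, ⟪S.df (φ r) (α r), α r⟫_ℝ)
  have h4 := sq_nonneg ‖α 0‖
  linarith

/-- The sampled running cost exceeds the running cost by `O(τ)` at most. The reason is that
`‖α t‖² + 2 L ∫ ‖α‖²` is nondecreasing in `t`, by the energy identity. -/
theorem sum_sampled_cost_le [CompleteSpace H] (hδ : 0 < δ) (hL : 0 ≤ L) (hα : Continuous α)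
    (hφ : Continuous φ)
    (hadj : ∀ s ∈ Set.Icc 0 T, ∀ t ∈ Set.Icc 0 T, α t = α s + ∫ r in s..t, S.adjointRHS α φ r)
    {τ : ℝ} (hτ : 0 < τ) {N : ℕ} (hNτ : (N : ℝ) * τ = T) :
    τ * ∑ n ∈ Finset.range N, ‖α (n * τ)‖ ^ 2 / 2 ≤
      (∫ t in (0 : ℝ)..T, ‖α t‖ ^ 2 / 2) + L * (∫ t in (0 : ℝ)..T, ‖α t‖ ^ 2) * τ := by
  have hc1 : Continuous fun t => ‖α t‖ ^ 2 / 2 := by fun_prop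
  have hc2 : Continuous fun t => ‖α t‖ ^ 2 := by fun_prop
  rw [← hNτ, ← sum_integral_steps hc1, ← sum_integral_steps hc2, Finset.mul_sum, Finset.mul_sum,
    Finset.sum_mul, ← Finset.sum_add_distrib]
  refine Finset.sum_le_sum fun n hn => ?_
  have hn' : ((n : ℝ) + 1) * τ ≤ T := by
    have : ((n + 1 : ℕ) : ℝ) ≤ N := by exact_mod_cast Finset.mem_range.1 hn
    push_cast at this
    rw [← hNτ]
    exact mul_le_mul_of_nonneg_right this hτ.le
  have hle : (n : ℝ) * τ ≤ (n + 1) * τ := by nlinarith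
  have hn0 : 0 ≤ (n : ℝ) * τ := by positivity
  set q := ∫ t in (n : ℝ) * τ..((n : ℝ) + 1) * τ, ‖α t‖ ^ 2 with hq
  have hpt : ∀ t ∈ Set.Icc ((n : ℝ) * τ) ((n + 1) * τ),
      ‖α (n * τ)‖ ^ 2 / 2 ≤ ‖α t‖ ^ 2 / 2 + L * q := by
    intro t ht
    have h1 := S.norm_sq_sub_norm_sq hα hφ hadj hn0 ht.1 (ht.2.trans hn')
    have h2 := S.abs_integral_df_le (φ := φ) hα ht.1
    have h3 := neg_abs_le (∫ r in (n : ℝ) * τ..t, ⟪S.df (φ r) (α r), α r⟫_ℝ)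
    have h4 : 0 ≤ ∫ r in (n : ℝ) * τ..t, ⟪S.A (α r), α r⟫_ℝ :=
      intervalIntegral.integral_nonneg ht.1 fun r _ => S.A_nonneg hδ _
    have h5 := mul_le_mul_of_nonneg_left
      (integral_nonneg_mono_right hc2 (fun t => sq_nonneg _) ht.1 ht.2) hL
    linarith
  have h6 := intervalIntegral.integral_mono_on (μ := MeasureTheory.volume) hle
    (f := fun _ => ‖α (n * τ)‖ ^ 2 / 2) (g := fun t => ‖α t‖ ^ 2 / 2 + L * q)
    intervalIntegrable_const (Continuous.intervalIntegrable (by fun_prop) _ _) hpt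
  rw [intervalIntegral.integral_add (hc1.intervalIntegrable _ _) intervalIntegrable_const,
    intervalIntegral.integral_const, intervalIntegral.integral_const, smul_eq_mul,
    smul_eq_mul] at h6
  linarith

/-- Testing the increment of the optimal control with a fixed vector. -/
theorem two_mul_inner_increment_le [CompleteSpace H] (hδ : 0 < δ) (hL : 0 ≤ L)
    (hα : Continuous α) (hφ : Continuous φ)
    (hadj : ∀ s ∈ Set.Icc 0 T, ∀ t ∈ Set.Icc 0 T, α t = α s + ∫ r in s..t, S.adjointRHS α φ r)
    {s t τ : ℝ} (hτ : 0 < τ) (hs : 0 ≤ s) (hst : s ≤ t) (htτ : t ≤ s + τ) (ht : t ≤ T) (e : H) :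
    2 * ⟪α t - α s, e⟫_ℝ ≤
      τ * (∫ r in s..(s + τ), (⟪S.A (α r), α r⟫_ℝ + L * ‖α r‖ ^ 2)) +
        (⟪S.A e, e⟫_ℝ + L * ‖e‖ ^ 2) := by
  have hmc := S.continuous_adjointRHS hα hφ
  set w := ⟪S.A e, e⟫_ℝ + L * ‖e‖ ^ 2 with hw
  have hw0 : 0 ≤ w := add_nonneg (S.A_nonneg hδ e) (by positivity)
  set g : ℝ → ℝ := fun r => ⟪S.A (α r), α r⟫_ℝ + L * ‖α r‖ ^ 2 with hg
  have hgc : Continuous g := by fun_prop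
  have hg0 : ∀ r, 0 ≤ g r := fun r => add_nonneg (S.A_nonneg hδ _) (by positivity)
  have h1 : 2 * ⟪α t - α s, e⟫_ℝ = ∫ r in s..t, 2 * ⟪S.adjointRHS α φ r, e⟫_ℝ := by
    rw [hadj s ⟨hs, hst.trans ht⟩ t ⟨hs.trans hst, ht⟩, add_sub_cancel_left, real_inner_comm]
    have := (innerSL ℝ e).intervalIntegral_comp_comm (μ := MeasureTheory.volume)
      (hmc.intervalIntegrable s t)
    simp only [innerSL_apply_apply] at this
    rw [← this, ← intervalIntegral.integral_const_mul]
    simp only [real_inner_comm]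
  -- With the weights `τ` and `τ⁻¹` the terms in `e` integrate to at most `w` over the step.
  have h2 : ∀ r, 2 * ⟪S.adjointRHS α φ r, e⟫_ℝ ≤ τ * g r + τ⁻¹ * w := by
    intro r
    have h3 := S.two_mul_abs_A_le hδ hτ (α r) e
    have h4 := le_abs_self ⟪S.A (α r), e⟫_ℝ
    have h5 : ⟪S.df (φ r) (α r), e⟫_ℝ ≤ L * (‖α r‖ * ‖e‖) := by
      refine (real_inner_le_norm _ _).trans ?_
      rw [← mul_assoc]
      exact mul_le_mul_of_nonneg_right (S.df_bound _ _) (norm_nonneg _)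
    have h6 : 2 * (‖α r‖ * ‖e‖) ≤ τ * ‖α r‖ ^ 2 + τ⁻¹ * ‖e‖ ^ 2 := by
      have h7 : 0 ≤ τ⁻¹ * (τ * ‖α r‖ - ‖e‖) ^ 2 := by positivity
      have h8 : τ⁻¹ * (τ * ‖α r‖ - ‖e‖) ^ 2 =
          τ * ‖α r‖ ^ 2 - 2 * (‖α r‖ * ‖e‖) + τ⁻¹ * ‖e‖ ^ 2 := by
        field_simp
        ring
      linarith
    have h9 := mul_le_mul_of_nonneg_left h6 hL
    rw [adjointRHS, inner_add_left]
    simp only [hg, hw]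
    nlinarith
  rw [h1]
  calc ∫ r in s..t, 2 * ⟪S.adjointRHS α φ r, e⟫_ℝ
      ≤ ∫ r in s..t, (τ * g r + τ⁻¹ * w) :=
        intervalIntegral.integral_mono_on hst
          (Continuous.intervalIntegrable (by fun_prop) _ _)
          (Continuous.intervalIntegrable (by fun_prop) _ _) fun r _ => h2 r
    _ ≤ ∫ r in s..(s + τ), (τ * g r + τ⁻¹ * w) :=
        integral_nonneg_mono_right (by fun_prop)
          (fun r => add_nonneg (mul_nonneg hτ.le (hg0 r)) (by positivity)) hst htτ
    _ = τ * (∫ r in s..(s + τ), g r) + w := by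
        rw [intervalIntegral.integral_add (Continuous.intervalIntegrable (by fun_prop) _ _)
          (Continuous.intervalIntegrable (by fun_prop) _ _),
          intervalIntegral.integral_const_mul, intervalIntegral.integral_const, smul_eq_mul,
          add_sub_cancel_left, mul_inv_cancel_left₀ hτ.ne']

/-- The growth over one time step of the distance between the state of the optimal control and the
Euler state of the sampled control. -/
theorem euler_step_error [CompleteSpace H] (hδ : 0 < δ) (hL : 0 ≤ L)
    (hα : Continuous α) (hφ : Continuous φ) (hstate : S.IsState T α φ)
    (hadj : ∀ s ∈ Set.Icc 0 T, ∀ t ∈ Set.Icc 0 T, α t = α s + ∫ r in s..t, S.adjointRHS α φ r)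
    {s τ C : ℝ} (hτ : 0 < τ) (hs : 0 ≤ s) (hsT : s + τ ≤ T) {u v : H}
    (hv : v = -S.A u - S.f u + α s) (hvC : ⟪S.A v, v⟫_ℝ ≤ δ * C ^ 2) :
    ‖φ (s + τ) - (u + τ • v)‖ ^ 2 ≤ Real.exp (4 * L * τ) * (‖φ s - u‖ ^ 2 + τ *
      ((δ + L) * C ^ 2 * τ ^ 2 +
        τ * ∫ r in s..(s + τ), (⟪S.A (α r), α r⟫_ℝ + L * ‖α r‖ ^ 2))) := by
  set I := ∫ r in s..(s + τ), (⟪S.A (α r), α r⟫_ℝ + L * ‖α r‖ ^ 2) with hI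
  have hI0 : 0 ≤ I := intervalIntegral.integral_nonneg (by linarith)
    fun r _ => add_nonneg (S.A_nonneg hδ _) (by positivity)
  have hd : ∀ x ∈ Set.Ioo s (s + τ), HasDerivAt (fun x => φ x - (u + (x - s) • v))
      ((-S.A (φ x) - S.f (φ x) + α x) - v) x := fun x hx =>
    (S.hasDerivAt_of_isState hα hφ hstate ⟨hs.trans_lt hx.1, hx.2.trans_le hsT⟩).sub
      (hasDerivAt_affine u v s x)
  have key := gronwall_of_hasDerivAt_Ioo (E := fun x => ‖φ x - (u + (x - s) • v)‖ ^ 2)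
    (s := s) (t := s + τ)
    (a := 4 * L) (b := (δ + L) * C ^ 2 * τ ^ 2 + τ * I) (by linarith) (by positivity)
    (by positivity) (Continuous.continuousOn (by fun_prop))
    (fun x hx => (hd x hx).norm_sq) ?_
  · simpa using key
  · intro x hx
    have hx0 : 0 ≤ x - s := by linarith [hx.1]
    have hxτ : x - s ≤ τ := by linarith [hx.2]
    set d := (x - s) • v with hddef
    set e := φ x - (u + d) with he
    have h1 : (-S.A (φ x) - S.f (φ x) + α x) - v =
        -S.A e - S.A d - (S.f (φ x) - S.f u) + (α x - α s) := by
      rw [he, hv]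
      simp only [map_sub, map_add]
      abel
    have h2 := S.two_mul_abs_A_le hδ (θ := 1) one_pos d e
    rw [inv_one, one_mul, one_mul] at h2
    have h3 : ⟪S.A d, d⟫_ℝ ≤ δ * C ^ 2 * τ ^ 2 := S.A_smul_le hδ hvC hx0 hxτ
    have h4 := neg_abs_le ⟪S.A d, e⟫_ℝ
    have h5 : ‖d‖ ^ 2 ≤ C ^ 2 * τ ^ 2 := S.norm_smul_le hδ hvC hx0 hxτ
    have h6 := S.two_mul_inner_increment_le hδ hL hα hφ hadj hτ hs hx.1.le hx.2.le
      (hx.2.le.trans hsT) e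
    rw [← hI] at h6
    have h7 : -⟪S.f (φ x) - S.f u, e⟫_ℝ ≤ L * ((‖e‖ + ‖d‖) * ‖e‖) := by
      rw [← inner_neg_left]
      refine (real_inner_le_norm _ _).trans ?_
      rw [norm_neg, ← mul_assoc]
      refine mul_le_mul_of_nonneg_right ((S.f_lipschitz _ _).trans ?_) (norm_nonneg _)
      refine mul_le_mul_of_nonneg_left ?_ hL
      have h8 : φ x - u = e + d := by
        rw [he]
        abel
      rw [h8]
      exact norm_add_le _ _
    have h9 : 2 * ((‖e‖ + ‖d‖) * ‖e‖) ≤ 3 * ‖e‖ ^ 2 + C ^ 2 * τ ^ 2 := by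
      nlinarith [sq_nonneg (‖e‖ - ‖d‖)]
    have h10 := mul_le_mul_of_nonneg_left h9 hL
    rw [h1, real_inner_comm, inner_add_left, inner_sub_left, inner_sub_left, inner_neg_left]
    nlinarith

end AdjointEquation

/-- The Euler pair obtained by sampling an optimal control costs at most `O(τ)` more than the
optimal control, provided that the increments of its state are moderate. Here `c τ` bounds the
distance of the final states. -/
theorem euler_cost_le [CompleteSpace H] (hδ : 0 < δ) (hL : 0 ≤ L) {T K C R : ℝ}
    (hT : 0 < T) (hK : 0 < K) {N : ℕ} (hN : 1 ≤ N) {p : H} {α φ : ℝ → H} {φr : ℕ → H}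
    (hα : Continuous α) (hφ : Continuous φ) (hstate : S.IsState T α φ)
    (hopt : S.IsOptimal T K p α φ) (h0 : φr 0 = φ 0)
    (hE : S.IsEuler (T / N) N (fun n => α (n * (T / N))) φr)
    (hv : ∀ n < N, ⟪S.A (S.velocity (fun n => α (n * (T / N))) φr n),
      S.velocity (fun n => α (n * (T / N))) φr n⟫_ℝ ≤ δ * C ^ 2)
    (hR : K * ‖φ T - p‖ ^ 2 + ∫ t in (0 : ℝ)..T, ‖α t‖ ^ 2 / 2 ≤ R)
    {c : ℝ} (hc : c = Real.sqrt (Real.exp (4 * L * T) *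
      ((δ + L) * C ^ 2 * T + (2 * K * R + 4 * L * R)))) :
    K * ‖φr N - p‖ ^ 2 + T / N * ∑ n ∈ Finset.range N, ‖α (n * (T / N))‖ ^ 2 / 2 ≤
      K * ‖φ T - p‖ ^ 2 + (∫ t in (0 : ℝ)..T, ‖α t‖ ^ 2 / 2) +
        ((c * (K + R) + K * c ^ 2 * T) + 2 * L * R) * (T / N) := by
  have hN0 : (0 : ℝ) < N := by exact_mod_cast hN
  set τ := T / N with hτdef
  have hτ : 0 < τ := div_pos hT hN0
  have hNτ : (N : ℝ) * τ = T := mul_div_cancel₀ T hN0.ne'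
  have hτT : τ ≤ T := by
    have : (1 : ℝ) ≤ N := by exact_mod_cast hN
    nlinarith
  obtain ⟨hterm, hadj⟩ := S.euler_lagrange hT hα hφ hstate hopt
  have hx0 : 0 ≤ K * ‖φ T - p‖ ^ 2 := by positivity
  have hi0 : 0 ≤ ∫ t in (0 : ℝ)..T, ‖α t‖ ^ 2 / 2 :=
    intervalIntegral.integral_nonneg hT.le fun t _ => by positivity
  have hR0 : 0 ≤ R := by linarith
  have hQ : ∫ t in (0 : ℝ)..T, ‖α t‖ ^ 2 ≤ 2 * R := by
    rw [intervalIntegral.integral_div] at hR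
    linarith
  have hαT : ‖α T‖ ^ 2 ≤ 4 * K * R := by
    rw [hterm, norm_neg, norm_smul, mul_pow, Real.norm_eq_abs, sq_abs]
    nlinarith
  set g : ℝ → ℝ := fun r => ⟪S.A (α r), α r⟫_ℝ + L * ‖α r‖ ^ 2 with hg
  have hgc : Continuous g := by fun_prop
  have hg0 : ∀ r, 0 ≤ g r := fun r => add_nonneg (S.A_nonneg hδ _) (by positivity)
  have hgI : ∫ r in (0 : ℝ)..T, g r ≤ 2 * K * R + 4 * L * R := by
    have h1 := S.integral_A_le hα hφ hT.le hadj
    simp only [hg]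
    rw [intervalIntegral.integral_add (Continuous.intervalIntegrable (by fun_prop) _ _)
      (Continuous.intervalIntegrable (by fun_prop) _ _), intervalIntegral.integral_const_mul]
    nlinarith
  have herr : ‖φr N - φ T‖ ^ 2 ≤ c ^ 2 * τ ^ 2 := by
    have hgron := discrete_gronwall (E := fun n => ‖φ (n * τ) - φr n‖ ^ 2)
      (b := fun n => (δ + L) * C ^ 2 * τ ^ 2 + τ * ∫ r in (n : ℝ) * τ..((n : ℝ) + 1) * τ, g r)
      (a := 4 * L) (τ := τ) (N := N) (by positivity) hτ.le ?_ (by simp [h0]) ?_ N le_rfl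
    · rw [hNτ, Finset.sum_add_distrib, ← Finset.mul_sum _ _ τ, sum_integral_steps hgc, hNτ] at hgron
      simp only [Finset.sum_const, Finset.card_range, nsmul_eq_mul] at hgron
      rw [norm_sub_rev, hc, Real.sq_sqrt (by positivity), mul_assoc]
      refine hgron.trans (mul_le_mul_of_nonneg_left ?_ (Real.exp_pos _).le)
      have h1 : τ * (N * ((δ + L) * C ^ 2 * τ ^ 2) + τ * ∫ r in (0 : ℝ)..T, g r) =
          ((δ + L) * C ^ 2 * (N * τ) + ∫ r in (0 : ℝ)..T, g r) * τ ^ 2 := by ring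
      rw [h1, hNτ]
      exact mul_le_mul_of_nonneg_right (add_le_add le_rfl hgI) (sq_nonneg τ)
    · intro n
      have : 0 ≤ ∫ r in (n : ℝ) * τ..((n : ℝ) + 1) * τ, g r :=
        intervalIntegral.integral_nonneg (by nlinarith) fun r _ => hg0 r
      positivity
    · intro n hn
      have h1 : ((n : ℝ) + 1) * τ = n * τ + τ := by ring
      have h2 : ((n : ℝ) + 1) * τ ≤ T := by
        have : ((n + 1 : ℕ) : ℝ) ≤ N := by exact_mod_cast hn
        push_cast at this
        rw [← hNτ]
        exact mul_le_mul_of_nonneg_right this hτ.le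
      have h3 := S.euler_step_error hδ hL hα hφ hstate hadj (s := n * τ) (C := C) hτ
        (by positivity) (by rw [← h1]; exact h2) (u := φr n) rfl (hv n hn)
      push_cast
      rw [h1, hE n hn]
      exact h3
  have hc0 : 0 ≤ c := hc ▸ Real.sqrt_nonneg _
  have hfin : K * ‖φr N - p‖ ^ 2 ≤
      K * ‖φ T - p‖ ^ 2 + (c * (K + R) + K * c ^ 2 * T) * τ := by
    refine sq_norm_sub_le_of_norm_sub_le hK (by linarith) hc0 hτ.le hτT ?_
    refine abs_le_of_sq_le_sq' ?_ (by positivity) |>.2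
    rw [mul_pow]
    exact herr
  have hrun := S.sum_sampled_cost_le hδ hL hα hφ hadj hτ hNτ
  have h4 : L * (∫ t in (0 : ℝ)..T, ‖α t‖ ^ 2) * τ ≤ L * (2 * R) * τ :=
    mul_le_mul_of_nonneg_right (mul_le_mul_of_nonneg_left hQ hL) hτ.le
  linarith

end ParabolicSystem

/-! ### The finite element space as a Hilbert space -/

section Functions

variable {M : ℕ}

theorem continuous_feFun (φ : feSpace M) : Continuous (feFun φ) :=
  (φ : ℝ →ᵇ ℝ).continuous

theorem feFun_add (φ ψ : feSpace M) (x : ℝ) : feFun (φ + ψ) x = feFun φ x + feFun ψ x := rfl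

theorem feFun_sub (φ ψ : feSpace M) (x : ℝ) : feFun (φ - ψ) x = feFun φ x - feFun ψ x := rfl

theorem feFun_smul (c : ℝ) (φ : feSpace M) (x : ℝ) : feFun (c • φ) x = c * feFun φ x := rfl

theorem feFun_zero (x : ℝ) : feFun (0 : feSpace M) x = 0 := rfl

theorem feFun_eq_zero_of_notMem (φ : feSpace M) {x : ℝ} (hx : x ∉ Set.Ioo (0 : ℝ) 1) :
    feFun φ x = 0 := φ.2.1 x hx

theorem fe_ext {φ ψ : feSpace M} (h : ∀ x ∈ Set.Icc (0 : ℝ) 1, feFun φ x = feFun ψ x) :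
    φ = ψ := by
  refine Subtype.ext (DFunLike.ext _ _ fun x => ?_)
  by_cases hx : x ∈ Set.Ioo (0 : ℝ) 1
  · exact h x ⟨hx.1.le, hx.2.le⟩
  · exact (feFun_eq_zero_of_notMem φ hx).trans (feFun_eq_zero_of_notMem ψ hx).symm

theorem l2Inner_comm (f g : ℝ → ℝ) : l2Inner f g = l2Inner g f := by
  simp only [l2Inner, mul_comm]

theorem l2Inner_self_nonneg (f : ℝ → ℝ) : 0 ≤ l2Inner f f :=
  intervalIntegral.integral_nonneg zero_le_one fun _ _ => mul_self_nonneg _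

theorem l2Norm_sq (f : ℝ → ℝ) : l2Norm f ^ 2 = l2Inner f f :=
  Real.sq_sqrt (l2Inner_self_nonneg f)

theorem intervalIntegrable_of_continuousOn {f : ℝ → ℝ} (hf : ContinuousOn f (Set.Icc 0 1)) :
    IntervalIntegrable f MeasureTheory.volume 0 1 :=
  ContinuousOn.intervalIntegrable (by rwa [Set.uIcc_of_le zero_le_one])

theorem l2Inner_add_left {f g h : ℝ → ℝ} (hf : ContinuousOn f (Set.Icc 0 1))
    (hg : ContinuousOn g (Set.Icc 0 1)) (hh : ContinuousOn h (Set.Icc 0 1)) :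
    l2Inner (fun x => f x + g x) h = l2Inner f h + l2Inner g h := by
  simp only [l2Inner, add_mul]
  exact intervalIntegral.integral_add (intervalIntegrable_of_continuousOn (hf.mul hh))
    (intervalIntegrable_of_continuousOn (hg.mul hh))

theorem l2Inner_sub_left {f g h : ℝ → ℝ} (hf : ContinuousOn f (Set.Icc 0 1))
    (hg : ContinuousOn g (Set.Icc 0 1)) (hh : ContinuousOn h (Set.Icc 0 1)) :
    l2Inner (fun x => f x - g x) h = l2Inner f h - l2Inner g h := by
  simp only [l2Inner, sub_mul]
  exact intervalIntegral.integral_sub (intervalIntegrable_of_continuousOn (hf.mul hh))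
    (intervalIntegrable_of_continuousOn (hg.mul hh))

theorem l2Inner_const_mul_left (c : ℝ) (f h : ℝ → ℝ) :
    l2Inner (fun x => c * f x) h = c * l2Inner f h := by
  simp only [l2Inner, mul_assoc]
  exact intervalIntegral.integral_const_mul _ _

theorem l2Inner_self_mono {f g : ℝ → ℝ} (hf : ContinuousOn f (Set.Icc 0 1))
    (hg : ContinuousOn g (Set.Icc 0 1)) (h : ∀ x ∈ Set.Icc (0 : ℝ) 1, |f x| ≤ |g x|) :
    l2Inner f f ≤ l2Inner g g := by
  refine intervalIntegral.integral_mono_on zero_le_one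
    (intervalIntegrable_of_continuousOn (hf.mul hf))
    (intervalIntegrable_of_continuousOn (hg.mul hg)) fun x hx => ?_
  rw [← abs_mul_abs_self (f x), ← abs_mul_abs_self (g x)]
  exact mul_self_le_mul_self (abs_nonneg _) (h x hx)

theorem two_mul_l2Inner_le {f g : ℝ → ℝ} (hf : ContinuousOn f (Set.Icc 0 1))
    (hg : ContinuousOn g (Set.Icc 0 1)) : 2 * l2Inner f g ≤ l2Inner f f + l2Inner g g := by
  have h1 : l2Inner f f + l2Inner g g = ∫ x in (0 : ℝ)..1, (f x * f x + g x * g x) :=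
    (intervalIntegral.integral_add (intervalIntegrable_of_continuousOn (hf.mul hf))
      (intervalIntegrable_of_continuousOn (hg.mul hg))).symm
  rw [h1, l2Inner, ← intervalIntegral.integral_const_mul]
  refine intervalIntegral.integral_mono_on zero_le_one
    ((intervalIntegrable_of_continuousOn (hf.mul hg)).const_mul 2)
    ((intervalIntegrable_of_continuousOn (hf.mul hf)).add
      (intervalIntegrable_of_continuousOn (hg.mul hg))) fun x _ => ?_
  nlinarith [sq_nonneg (f x - g x)]

end Functions

/-- The inner product space structure on `feSpace M` given by the `L²(0,1)` inner product. -/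
@[reducible] noncomputable def feCore (M : ℕ) : InnerProductSpace.Core ℝ (feSpace M) where
  inner φ ψ := l2Inner (feFun φ) (feFun ψ)
  conj_inner_symm φ ψ := l2Inner_comm _ _
  re_inner_nonneg φ := l2Inner_self_nonneg _
  add_left φ ψ χ := l2Inner_add_left (continuous_feFun φ).continuousOn
    (continuous_feFun ψ).continuousOn (continuous_feFun χ).continuousOn
  smul_left φ ψ c := l2Inner_const_mul_left c _ _
  definite φ h := by
    have hc : Continuous fun x => feFun φ x * feFun φ x :=
      (continuous_feFun φ).mul (continuous_feFun φ)
    refine fe_ext fun x hx => ?_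
    by_contra hne
    have h2 := intervalIntegral.integral_pos (zero_lt_one' ℝ) hc.continuousOn
      (fun x _ => mul_self_nonneg (feFun φ x)) ⟨x, hx, mul_self_pos.2 hne⟩
    exact h2.ne' h

/-- The finite element space with the `L²(0,1)` norm instead of the supremum norm. -/
def FEHilbert (M : ℕ) : Type := feSpace M

noncomputable instance (M : ℕ) : NormedAddCommGroup (FEHilbert M) :=
  @InnerProductSpace.Core.toNormedAddCommGroup ℝ (feSpace M) _ _ _ (feCore M)

noncomputable instance (M : ℕ) : InnerProductSpace ℝ (FEHilbert M) :=
  @InnerProductSpace.ofCore ℝ (feSpace M) _ _ _ (feCore M).toCore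

/-- The identity map from `feSpace M` to `FEHilbert M`. -/
noncomputable def toHilbert (M : ℕ) : feSpace M ≃ₗ[ℝ] FEHilbert M where
  toFun φ := φ
  invFun φ := φ
  map_add' _ _ := rfl
  map_smul' _ _ := rfl
  left_inv _ := rfl
  right_inv _ := rfl

section Cells

variable {M : ℕ}

theorem inner_toHilbert (φ ψ : feSpace M) :
    ⟪toHilbert M φ, toHilbert M ψ⟫_ℝ = l2Inner (feFun φ) (feFun ψ) := rfl

theorem norm_toHilbert_sq (φ : feSpace M) :
    ‖toHilbert M φ‖ ^ 2 = l2Inner (feFun φ) (feFun φ) := by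
  rw [← real_inner_self_eq_norm_sq, inner_toHilbert]

/-- The slope of a finite element function on the `i`-th cell. -/
noncomputable def feSlope (φ : feSpace M) (i : ℕ) : ℝ :=
  M * (feFun φ (((i : ℝ) + 1) / M) - feFun φ ((i : ℝ) / M))

theorem feSlope_sub (φ ψ : feSpace M) (i : ℕ) :
    feSlope (φ - ψ) i = feSlope φ i - feSlope ψ i := by
  simp only [feSlope, feFun_sub]
  ring

theorem feSlope_add (φ ψ : feSpace M) (i : ℕ) :
    feSlope (φ + ψ) i = feSlope φ i + feSlope ψ i := by
  simp only [feSlope, feFun_add]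
  ring

theorem feSlope_smul (c : ℝ) (φ : feSpace M) (i : ℕ) : feSlope (c • φ) i = c * feSlope φ i := by
  simp only [feSlope, feFun_smul]
  ring

theorem cell_le (i : ℕ) : (i : ℝ) / M ≤ ((i : ℝ) + 1) / M := by
  gcongr
  linarith

theorem feFun_eq_on_cell (hM : 1 ≤ M) (φ : feSpace M) {i : ℕ} (hi : i < M) {x : ℝ}
    (hx : x ∈ Set.Icc ((i : ℝ) / M) (((i : ℝ) + 1) / M)) :
    feFun φ x = feFun φ ((i : ℝ) / M) + feSlope φ i * (x - (i : ℝ) / M) := by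
  obtain ⟨a, b, h⟩ := φ.2.2 i hi
  have h1 : feFun φ ((i : ℝ) / M) = a * ((i : ℝ) / M) + b := h _ ⟨le_rfl, cell_le i⟩
  have h2 : feFun φ (((i : ℝ) + 1) / M) = a * (((i : ℝ) + 1) / M) + b :=
    h _ ⟨cell_le i, le_rfl⟩
  have h3 : feFun φ x = a * x + b := h x hx
  have hM0 : (M : ℝ) ≠ 0 := by positivity
  rw [feSlope, h1, h2, h3]
  field_simp
  ring

theorem exists_cell (hM : 1 ≤ M) {x : ℝ} (hx : x ∈ Set.Ico (0 : ℝ) 1) :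
    ∃ i < M, x ∈ Set.Icc ((i : ℝ) / M) (((i : ℝ) + 1) / M) := by
  have hM0 : (0 : ℝ) < M := by exact_mod_cast hM
  have h0 : 0 ≤ x * M := mul_nonneg hx.1 hM0.le
  refine ⟨⌊x * M⌋₊, ?_, (div_le_iff₀ hM0).2 (Nat.floor_le h0),
    (le_div_iff₀ hM0).2 (Nat.lt_floor_add_one _).le⟩
  rw [Nat.floor_lt h0]
  nlinarith [hx.2]

theorem feDeriv_eq_on_cell (hM : 1 ≤ M) (φ : feSpace M) {i : ℕ} (hi : i < M) {x : ℝ}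
    (hx : x ∈ Set.Ioo ((i : ℝ) / M) (((i : ℝ) + 1) / M)) : feDeriv φ x = feSlope φ i := by
  have h1 : HasDerivAt (fun x => feFun φ ((i : ℝ) / M) + feSlope φ i * (x - (i : ℝ) / M))
      (feSlope φ i) x := by
    simpa using (((hasDerivAt_id x).sub_const ((i : ℝ) / M)).const_mul (feSlope φ i)).const_add
      (feFun φ ((i : ℝ) / M))
  refine (h1.congr_of_eventuallyEq ?_).deriv
  filter_upwards [isOpen_Ioo.mem_nhds hx] with y hy
  exact feFun_eq_on_cell hM φ hi ⟨hy.1.le, hy.2.le⟩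

/-- The integral of a function that is constant on the open cells. -/
theorem integral_eq_sum_cells (hM : 1 ≤ M) {k : ℝ → ℝ} {c : ℕ → ℝ}
    (h : ∀ i < M, ∀ x ∈ Set.Ioo ((i : ℝ) / M) (((i : ℝ) + 1) / M), k x = c i) :
    ∫ x in (0 : ℝ)..1, k x = (∑ i ∈ Finset.range M, c i) / M := by
  have hM0 : (M : ℝ) ≠ 0 := by positivity
  have hEq : ∀ i < M, Set.EqOn (fun _ => c i) k
      (Set.uIoo ((i : ℝ) / M) (((i + 1 : ℕ) : ℝ) / M)) := by
    intro i hi x hx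
    push_cast at hx
    rw [Set.uIoo_of_le (cell_le i)] at hx
    exact (h i hi x hx).symm
  have h1 := intervalIntegral.sum_integral_adjacent_intervals (f := k)
    (μ := MeasureTheory.volume) (a := fun i : ℕ => (i : ℝ) / M) (n := M)
    fun i hi => intervalIntegrable_const.congr_uIoo (hEq i hi)
  simp only [Nat.cast_zero, zero_div, div_self hM0] at h1
  rw [← h1, Finset.sum_div]
  refine Finset.sum_congr rfl fun i hi => ?_
  rw [← intervalIntegral.integral_congr_uIoo (hEq i (Finset.mem_range.1 hi)),
    intervalIntegral.integral_const, smul_eq_mul]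
  push_cast
  ring

theorem l2Inner_feDeriv (hM : 1 ≤ M) (φ ψ : feSpace M) :
    l2Inner (feDeriv φ) (feDeriv ψ) =
      (∑ i ∈ Finset.range M, feSlope φ i * feSlope ψ i) / M :=
  integral_eq_sum_cells hM fun i hi x hx => by
    rw [feDeriv_eq_on_cell hM φ hi hx, feDeriv_eq_on_cell hM ψ hi hx]

theorem l2Norm_feDeriv_sub_sq (hM : 1 ≤ M) (φ ψ : feSpace M) :
    l2Norm (fun x => feDeriv φ x - feDeriv ψ x) ^ 2 =
      l2Inner (feDeriv (φ - ψ)) (feDeriv (φ - ψ)) := by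
  rw [l2Norm_sq, l2Inner_feDeriv hM]
  refine integral_eq_sum_cells hM fun i hi x hx => ?_
  dsimp only
  rw [feDeriv_eq_on_cell hM φ hi hx, feDeriv_eq_on_cell hM ψ hi hx, feSlope_sub]

theorem feFun_node (hM : 1 ≤ M) (φ : feSpace M) (i : ℕ) :
    feFun φ ((i : ℝ) / M) = (∑ j ∈ Finset.range i, feSlope φ j) / M := by
  have hM0 : (M : ℝ) ≠ 0 := by positivity
  have h0 : feFun φ (((0 : ℕ) : ℝ) / M) = 0 := feFun_eq_zero_of_notMem φ (by simp)
  have h1 := Finset.sum_range_sub (fun j : ℕ => feFun φ ((j : ℝ) / M)) i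
  simp only [h0, sub_zero] at h1
  rw [← h1]
  simp only [feSlope, ← Finset.mul_sum]
  push_cast
  field_simp

/-- The one-dimensional Poincaré inequality, with the supremum norm on the left. -/
theorem sq_feFun_le (hM : 1 ≤ M) (φ : feSpace M) (x : ℝ) :
    feFun φ x ^ 2 ≤ l2Inner (feDeriv φ) (feDeriv φ) := by
  have hM0 : (0 : ℝ) < M := by exact_mod_cast hM
  set B := (∑ j ∈ Finset.range M, |feSlope φ j|) / M with hB
  have hB0 : 0 ≤ B := div_nonneg (Finset.sum_nonneg fun _ _ => abs_nonneg _) hM0.le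
  have hsq : B ^ 2 ≤ l2Inner (feDeriv φ) (feDeriv φ) := by
    have h1 := sq_sum_le_card_mul_sum_sq (s := Finset.range M) (f := fun j => |feSlope φ j|)
    simp only [Finset.card_range, sq_abs] at h1
    rw [l2Inner_feDeriv hM, hB, div_pow, div_le_div_iff₀ (by positivity) hM0]
    simp only [← pow_two]
    nlinarith
  refine le_trans ?_ hsq
  rw [← sq_abs]
  refine pow_le_pow_left₀ (abs_nonneg _) ?_ 2
  have hnode : ∀ i ≤ M, |feFun φ ((i : ℝ) / M)| ≤ B := by
    intro i hi
    rw [feFun_node hM, abs_div, abs_of_pos hM0, hB]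
    refine div_le_div_of_nonneg_right ((Finset.abs_sum_le_sum_abs _ _).trans ?_) hM0.le
    exact Finset.sum_le_sum_of_subset_of_nonneg (Finset.range_mono hi) fun _ _ _ => abs_nonneg _
  by_cases hx : x ∈ Set.Ioo (0 : ℝ) 1
  · obtain ⟨i, hi, hxi⟩ := exists_cell hM ⟨hx.1.le, hx.2⟩
    have h1 := hnode i hi.le
    have h2 := hnode (i + 1) hi
    push_cast at h2
    set θ := M * (x - i / M) with hθ
    have hθ0 : 0 ≤ θ := mul_nonneg hM0.le (by linarith [hxi.1])
    have hθ1 : θ ≤ 1 := by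
      have h3 := (le_div_iff₀ hM0).1 hxi.2
      have h4 : θ = x * M - i := by
        rw [hθ]
        field_simp
      linarith
    have h5 : feFun φ x = (1 - θ) * feFun φ ((i : ℝ) / M) +
        θ * feFun φ (((i : ℝ) + 1) / M) := by
      rw [feFun_eq_on_cell hM φ hi hxi, feSlope, hθ]
      ring
    rw [abs_le] at h1 h2 ⊢
    rw [h5]
    constructor <;> nlinarith
  · rw [feFun_eq_zero_of_notMem φ hx, abs_zero]
    exact hB0

theorem l2Inner_self_le_l2Inner_feDeriv (hM : 1 ≤ M) (φ : feSpace M) :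
    l2Inner (feFun φ) (feFun φ) ≤ l2Inner (feDeriv φ) (feDeriv φ) := by
  have hc := (continuous_feFun φ).mul (continuous_feFun φ)
  have h1 := intervalIntegral.integral_mono_on (μ := MeasureTheory.volume) zero_le_one
    (hc.intervalIntegrable 0 1)
    (intervalIntegrable_const (c := l2Inner (feDeriv φ) (feDeriv φ)))
    fun x _ => by
      have := sq_feFun_le hM φ x
      rwa [pow_two] at this
  rw [intervalIntegral.integral_const, smul_eq_mul, sub_zero, one_mul] at h1
  exact h1

/-- A finite element function is determined by its slopes. -/
theorem finiteDimensional_feSpace (hM : 1 ≤ M) : FiniteDimensional ℝ (feSpace M) := by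
  let F : feSpace M →ₗ[ℝ] (Fin M → ℝ) :=
    { toFun := fun φ i => feSlope φ i
      map_add' := fun φ ψ => funext fun i => feSlope_add φ ψ i
      map_smul' := fun c φ => funext fun i => feSlope_smul c φ i }
  refine FiniteDimensional.of_injective F fun φ ψ h => fe_ext fun x _ => ?_
  have h1 := sq_feFun_le hM (φ - ψ) x
  rw [l2Inner_feDeriv hM, Finset.sum_eq_zero, zero_div] at h1
  · exact sub_eq_zero.1 (pow_eq_zero_iff two_ne_zero |>.1 (le_antisymm h1 (sq_nonneg _)))
  · intro i hi
    have h2 : feSlope φ i = feSlope ψ i := congrFun h ⟨i, Finset.mem_range.1 hi⟩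
    rw [feSlope_sub, h2, sub_self, zero_mul]

theorem finiteDimensional_FEHilbert (hM : 1 ≤ M) : FiniteDimensional ℝ (FEHilbert M) :=
  let _ := finiteDimensional_feSpace hM
  Module.Finite.equiv (toHilbert M)

end Cells

/-! ### The semidiscrete Ginzburg–Landau equation as a parabolic system -/

variable {M : ℕ}

/-- The function underlying an element of `FEHilbert M`. -/
noncomputable def hFun (u : FEHilbert M) : ℝ → ℝ := feFun ((toHilbert M).symm u)

theorem continuous_hFun (u : FEHilbert M) : Continuous (hFun u) := continuous_feFun _

theorem inner_eq_l2Inner (u v : FEHilbert M) : ⟪u, v⟫_ℝ = l2Inner (hFun u) (hFun v) := rfl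

theorem norm_sq_eq_l2Inner (u : FEHilbert M) : ‖u‖ ^ 2 = l2Inner (hFun u) (hFun u) := by
  rw [← real_inner_self_eq_norm_sq, inner_eq_l2Inner]

theorem norm_toHilbert_le (φ : feSpace M) : ‖toHilbert M φ‖ ≤ ‖φ‖ := by
  refine abs_le_of_sq_le_sq' ?_ (norm_nonneg φ) |>.2
  have hc := (continuous_feFun φ).fun_mul (continuous_feFun φ)
  have h1 := intervalIntegral.integral_mono_on (μ := MeasureTheory.volume) zero_le_one
    (hc.intervalIntegrable 0 1) (intervalIntegrable_const (c := ‖φ‖ ^ 2)) fun x _ => by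
      rw [← abs_mul_abs_self, pow_two]
      exact mul_self_le_mul_self (abs_nonneg _) ((φ : ℝ →ᵇ ℝ).norm_coe_le_norm x)
  rw [intervalIntegral.integral_const, smul_eq_mul, sub_zero, one_mul] at h1
  rw [norm_toHilbert_sq]
  exact h1

theorem continuous_toHilbert : Continuous (toHilbert M) := by
  refine (LipschitzWith.of_dist_le_mul (K := 1) fun φ ψ => ?_).continuous
  have h1 : dist φ ψ = ‖φ - ψ‖ := dist_eq_norm φ ψ
  rw [h1, dist_eq_norm, ← map_sub, NNReal.coe_one, one_mul]
  exact norm_toHilbert_le (φ - ψ)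

theorem exists_inner_eq_linearMap [FiniteDimensional ℝ (FEHilbert M)] (l : FEHilbert M →ₗ[ℝ] ℝ) :
    ∃ p : FEHilbert M, ∀ v, ⟪p, v⟫_ℝ = l v := by
  have _ : CompleteSpace (FEHilbert M) := FiniteDimensional.complete ℝ _
  refine ⟨(InnerProductSpace.toDual ℝ _).symm (LinearMap.toContinuousLinearMap l), fun v => ?_⟩
  rw [InnerProductSpace.toDual_symm_apply]
  rfl

/-- The `L²(0,1)` projection to the finite element space. Its value is meaningful for functions
that are continuous on `[0,1]` (see `inner_feProj`), and arbitrary otherwise. -/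
noncomputable def feProj (M : ℕ) (k : ℝ → ℝ) : FEHilbert M :=
  Classical.epsilon fun p => ∀ v : FEHilbert M, ⟪p, v⟫_ℝ = l2Inner k (hFun v)

section Projection

variable [FiniteDimensional ℝ (FEHilbert M)]

theorem inner_feProj {k : ℝ → ℝ} (hk : ContinuousOn k (Set.Icc 0 1)) (v : FEHilbert M) :
    ⟪feProj M k, v⟫_ℝ = l2Inner k (hFun v) := by
  let l : FEHilbert M →ₗ[ℝ] ℝ :=
    { toFun := fun v => l2Inner k (hFun v)
      map_add' := fun v w => by
        rw [l2Inner_comm, l2Inner_comm k, l2Inner_comm k]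
        exact l2Inner_add_left (continuous_hFun v).continuousOn (continuous_hFun w).continuousOn hk
      map_smul' := fun c v => by
        rw [l2Inner_comm, l2Inner_comm k]
        exact l2Inner_const_mul_left c _ _ }
  exact Classical.epsilon_spec (p := fun p => ∀ v : FEHilbert M, ⟪p, v⟫_ℝ = l2Inner k (hFun v))
    (exists_inner_eq_linearMap l) v

theorem norm_feProj_sq_le {k : ℝ → ℝ} (hk : ContinuousOn k (Set.Icc 0 1)) :
    ‖feProj M k‖ ^ 2 ≤ l2Inner k k := by
  have h1 := inner_feProj hk (feProj M k)
  rw [real_inner_self_eq_norm_sq] at h1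
  have h2 := two_mul_l2Inner_le hk (continuous_hFun (feProj M k)).continuousOn
  rw [← norm_sq_eq_l2Inner, ← h1] at h2
  linarith

theorem norm_feProj_le {k : ℝ → ℝ} (hk : ContinuousOn k (Set.Icc 0 1)) {c : ℝ} (hc : 0 ≤ c)
    (w : FEHilbert M) (h : ∀ x, |k x| ≤ c * |hFun w x|) : ‖feProj M k‖ ≤ c * ‖w‖ := by
  refine abs_le_of_sq_le_sq' ((norm_feProj_sq_le hk).trans ?_) (by positivity) |>.2
  have hw : ContinuousOn (fun x => c * hFun w x) (Set.Icc 0 1) :=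
    ((continuous_hFun w).const_mul c).continuousOn
  refine (l2Inner_self_mono hk hw fun x _ => ?_).trans (le_of_eq ?_)
  · rw [abs_mul, abs_of_nonneg hc]
    exact h x
  · rw [l2Inner_const_mul_left, l2Inner_comm, l2Inner_const_mul_left, ← norm_sq_eq_l2Inner]
    ring

theorem feProj_sub {k l : ℝ → ℝ} (hk : ContinuousOn k (Set.Icc 0 1))
    (hl : ContinuousOn l (Set.Icc 0 1)) :
    feProj M k - feProj M l = feProj M fun x => k x - l x := by
  refine ext_inner_right ℝ fun v => ?_
  rw [inner_sub_left, inner_feProj hk, inner_feProj hl, inner_feProj (hk.fun_sub hl),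
    l2Inner_sub_left hk hl (continuous_hFun v).continuousOn]

/-- On the finite dimensional space the supremum norm is bounded by the `L²` norm. -/
theorem exists_abs_hFun_le : ∃ c, 0 ≤ c ∧ ∀ (u : FEHilbert M) x, |hFun u x| ≤ c * ‖u‖ := by
  let E : FEHilbert M →ₗ[ℝ] (ℝ →ᵇ ℝ) :=
    { toFun := fun u => ((toHilbert M).symm u : ℝ →ᵇ ℝ)
      map_add' := fun _ _ => rfl
      map_smul' := fun _ _ => rfl }
  obtain ⟨c, hc0, hc⟩ := (LinearMap.toContinuousLinearMap E).bound
  exact ⟨c, hc0.le, fun u x => ((E u).norm_coe_le_norm x).trans (hc u)⟩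

theorem continuous_toHilbert_symm : Continuous (toHilbert M).symm := by
  obtain ⟨c, hc0, hc⟩ := exists_abs_hFun_le (M := M)
  refine (LipschitzWith.of_dist_le_mul (K := Real.toNNReal c) fun u v => ?_).continuous
  have h1 : dist ((toHilbert M).symm u) ((toHilbert M).symm v) =
      ‖(((toHilbert M).symm (u - v) : feSpace M) : ℝ →ᵇ ℝ)‖ :=
    dist_eq_norm ((toHilbert M).symm u).1 ((toHilbert M).symm v).1
  rw [h1, dist_eq_norm, Real.coe_toNNReal c hc0]
  exact (BoundedContinuousFunction.norm_le (by positivity)).2 fun x => hc (u - v) x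

end Projection

/-- The regularity of the potential that the estimates use: `V'` and `V''` are continuous, bounded by
`B₁` and `B₂`, and Lipschitz with constants `B₂` and `B₃`, so that the first order Taylor remainder
of `V'` is at most `B₃ h²`. -/
structure PotentialBounds (V : ℝ → ℝ) (B₁ B₂ B₃ : ℝ) : Prop where
  continuous_deriv : Continuous (deriv V)
  continuous_deriv2 : Continuous (deriv (deriv V))
  abs_deriv_le : ∀ x, |deriv V x| ≤ B₁
  abs_deriv2_le : ∀ x, |deriv (deriv V) x| ≤ B₂
  lipschitz_deriv : ∀ x y, |deriv V x - deriv V y| ≤ B₂ * |x - y|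
  lipschitz_deriv2 : ∀ x y, |deriv (deriv V) x - deriv (deriv V) y| ≤ B₃ * |x - y|
  taylor : ∀ x h, |deriv V (x + h) - deriv V x - deriv (deriv V) x * h| ≤ B₃ * |h| * |h|

theorem exists_potentialBounds {V : ℝ → ℝ} (hV : ContDiff ℝ 3 V)
    (hVb : ∀ k : ℕ, 1 ≤ k → k ≤ 3 → ∃ B : ℝ, ∀ x : ℝ, |iteratedDeriv k V x| ≤ B) :
    ∃ B₁ B₂ B₃, PotentialBounds V B₁ B₂ B₃ := by
  obtain ⟨B₁, h1⟩ := hVb 1 le_rfl (by norm_num)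
  obtain ⟨B₂, h2⟩ := hVb 2 (by norm_num) (by norm_num)
  obtain ⟨B₃, h3⟩ := hVb 3 (by norm_num) le_rfl
  rw [iteratedDeriv_one] at h1
  rw [iteratedDeriv_succ, iteratedDeriv_one] at h2
  rw [iteratedDeriv_succ, iteratedDeriv_succ, iteratedDeriv_one] at h3
  have hd1 : ContDiff ℝ 2 (deriv V) := hV.deriv'
  have hd2 : ContDiff ℝ 1 (deriv (deriv V)) := hd1.deriv'
  have lip1 : ∀ x y, |deriv V x - deriv V y| ≤ B₂ * |x - y| := fun x y =>
    convex_univ.norm_image_sub_le_of_norm_deriv_le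
      (fun z _ => (hd1.differentiable (by norm_num)) z) (fun z _ => h2 z) trivial trivial
  have lip2 : ∀ x y, |deriv (deriv V) x - deriv (deriv V) y| ≤ B₃ * |x - y| := fun x y =>
    convex_univ.norm_image_sub_le_of_norm_deriv_le
      (fun z _ => (hd2.differentiable (by norm_num)) z) (fun z _ => h3 z) trivial trivial
  have hB₃ : 0 ≤ B₃ := (abs_nonneg _).trans (h3 0)
  refine ⟨B₁, B₂, B₃, hd1.continuous, hd2.continuous, h1, h2, lip1, lip2, fun x h => ?_⟩
  have hd : ∀ z ∈ Set.uIcc x (x + h), HasDerivWithinAt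
      (fun z => deriv V z - deriv (deriv V) x * z) (deriv (deriv V) z - deriv (deriv V) x)
      (Set.uIcc x (x + h)) z := by
    intro z _
    have h4 := ((hd1.differentiable (by norm_num)) z).hasDerivAt
    have h5 := (hasDerivAt_id z).const_mul (deriv (deriv V) x)
    rw [mul_one] at h5
    exact (h4.sub h5).hasDerivWithinAt
  have h6 := (convex_uIcc x (x + h)).norm_image_sub_le_of_norm_hasDerivWithin_le (C := B₃ * |h|)
    hd (fun z hz => (lip2 z x).trans (mul_le_mul_of_nonneg_left ?_ hB₃))
    Set.left_mem_uIcc Set.right_mem_uIcc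
  · rw [add_sub_cancel_left] at h6
    refine le_trans (le_of_eq ?_) h6
    rw [Real.norm_eq_abs]
    congr 1
    ring
  · have := Set.abs_sub_left_of_mem_uIcc hz
    rwa [add_sub_cancel_left] at this

/-- The semidiscrete equation is a parabolic system whose constants do not depend on the mesh. The
bound for the Taylor remainder does depend on it, through the comparison of the supremum norm with
the `L²` norm. -/
theorem exists_parabolicSystem (hM : 1 ≤ M) [FiniteDimensional ℝ (FEHilbert M)] {δ : ℝ}
    (hδ : 0 < δ) {V : ℝ → ℝ} {B₁ B₂ B₃ : ℝ} (hV : PotentialBounds V B₁ B₂ B₃) :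
    ∃ S : ParabolicSystem (FEHilbert M) δ (δ⁻¹ * B₂),
      (∀ u v : feSpace M, ⟪S.A (toHilbert M u), toHilbert M v⟫_ℝ =
        δ * l2Inner (feDeriv u) (feDeriv v)) ∧
      ∀ u v : feSpace M, ⟪S.f (toHilbert M u), toHilbert M v⟫_ℝ =
        δ⁻¹ * l2Inner (fun x => deriv V (feFun u x)) (feFun v) := by
  have hB₂ : 0 ≤ B₂ := (abs_nonneg _).trans (hV.abs_deriv2_le 0)
  have hB₃ : 0 ≤ B₃ := by
    have := hV.lipschitz_deriv2 1 0
    rw [sub_zero, abs_one, mul_one] at this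
    exact (abs_nonneg _).trans this
  have hδi : 0 < δ⁻¹ := inv_pos.2 hδ
  obtain ⟨c, hc0, hc⟩ := exists_abs_hFun_le (M := M)
  have hform_comm : ∀ φ ψ : feSpace M,
      l2Inner (feDeriv φ) (feDeriv ψ) = l2Inner (feDeriv ψ) (feDeriv φ) := fun φ ψ =>
    l2Inner_comm _ _
  have hform_add : ∀ φ ψ χ : feSpace M, l2Inner (feDeriv (φ + ψ)) (feDeriv χ) =
      l2Inner (feDeriv φ) (feDeriv χ) + l2Inner (feDeriv ψ) (feDeriv χ) := by
    intro φ ψ χ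
    simp only [l2Inner_feDeriv hM, feSlope_add, add_mul, Finset.sum_add_distrib, add_div]
  have hform_smul : ∀ (a : ℝ) (φ χ : feSpace M), l2Inner (feDeriv (a • φ)) (feDeriv χ) =
      a * l2Inner (feDeriv φ) (feDeriv χ) := by
    intro a φ χ
    simp only [l2Inner_feDeriv hM, feSlope_smul, mul_assoc, ← Finset.mul_sum, mul_div_assoc]
  -- The stiffness operator represents `δ` times the energy form.
  have hform : ∀ u : FEHilbert M, ∃ w : FEHilbert M, ∀ v : FEHilbert M, ⟪w, v⟫_ℝ =
      δ * l2Inner (feDeriv ((toHilbert M).symm u)) (feDeriv ((toHilbert M).symm v)) := by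
    intro u
    let l : FEHilbert M →ₗ[ℝ] ℝ :=
      { toFun := fun v =>
          δ * l2Inner (feDeriv ((toHilbert M).symm u)) (feDeriv ((toHilbert M).symm v))
        map_add' := fun v w => by
          rw [map_add, hform_comm, hform_add, mul_add, hform_comm,
            hform_comm ((toHilbert M).symm w)]
        map_smul' := fun a v => by
          rw [map_smul, hform_comm, hform_smul, hform_comm, RingHom.id_apply, smul_eq_mul]
          ring }
    exact exists_inner_eq_linearMap l
  choose A hA using hform
  let AL : FEHilbert M →ₗ[ℝ] FEHilbert M :=
    { toFun := A
      map_add' := fun u w => ext_inner_right ℝ fun v => by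
        rw [inner_add_left, hA, hA, hA, map_add, hform_add, mul_add]
      map_smul' := fun a u => ext_inner_right ℝ fun v => by
        rw [RingHom.id_apply, real_inner_smul_left, hA, hA, map_smul, hform_smul]
        ring }
  -- The coefficient functions are continuous, so that the projections are meaningful.
  have hkc : ∀ u : FEHilbert M, Continuous fun x => δ⁻¹ * deriv V (hFun u x) := fun u =>
    (hV.continuous_deriv.comp (continuous_hFun u)).const_mul _
  have hdc : ∀ u v : FEHilbert M,
      Continuous fun x => δ⁻¹ * (deriv (deriv V) (hFun u x) * hFun v x) := fun u v =>
    ((hV.continuous_deriv2.comp (continuous_hFun u)).mul (continuous_hFun v)).const_mul _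
  set f : FEHilbert M → FEHilbert M := fun u => feProj M fun x => δ⁻¹ * deriv V (hFun u x) with hf
  set df : FEHilbert M → FEHilbert M → FEHilbert M := fun u v =>
    feProj M fun x => δ⁻¹ * (deriv (deriv V) (hFun u x) * hFun v x) with hdf
  have hdf_bound : ∀ u v, ‖df u v‖ ≤ δ⁻¹ * B₂ * ‖v‖ := by
    intro u v
    refine norm_feProj_le (hdc u v).continuousOn (by positivity) v fun x => ?_
    rw [abs_mul, abs_mul, abs_of_pos hδi, mul_assoc]
    gcongr
    exact hV.abs_deriv2_le _
  have hdf_sub_right : ∀ u v w, df u v - df u w = df u (v - w) := by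
    intro u v w
    simp only [hdf]
    rw [feProj_sub (hdc u v).continuousOn (hdc u w).continuousOn]
    congr 1
    funext x
    have : hFun (v - w) x = hFun v x - hFun w x := rfl
    rw [this]
    ring
  have hdf_lip : ∀ u w v, ‖df u v - df w v‖ ≤ δ⁻¹ * B₃ * (c * ‖v‖) * ‖u - w‖ := by
    intro u w v
    simp only [hdf]
    rw [feProj_sub (hdc u v).continuousOn (hdc w v).continuousOn]
    refine norm_feProj_le ((hdc u v).fun_sub (hdc w v)).continuousOn (by positivity) (u - w)
      fun x => ?_
    have h1 : hFun (u - w) x = hFun u x - hFun w x := rfl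
    have h2 := hV.lipschitz_deriv2 (hFun u x) (hFun w x)
    rw [← mul_sub, ← sub_mul, abs_mul, abs_mul, abs_of_pos hδi, h1]
    calc δ⁻¹ * (|deriv (deriv V) (hFun u x) - deriv (deriv V) (hFun w x)| * |hFun v x|)
        ≤ δ⁻¹ * ((B₃ * |hFun u x - hFun w x|) * (c * ‖v‖)) := by
          gcongr
          exact hc v x
      _ = δ⁻¹ * B₃ * (c * ‖v‖) * |hFun u x - hFun w x| := by ring
  have hdf_cont : Continuous fun z : FEHilbert M × FEHilbert M => df z.1 z.2 := by
    rw [continuous_iff_continuousAt]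
    rintro ⟨u₀, v₀⟩
    rw [ContinuousAt, tendsto_iff_norm_sub_tendsto_zero]
    have hlim : Filter.Tendsto (fun z : FEHilbert M × FEHilbert M =>
        δ⁻¹ * B₂ * ‖z.2 - v₀‖ + δ⁻¹ * B₃ * (c * ‖v₀‖) * ‖z.1 - u₀‖) (nhds (u₀, v₀)) (nhds 0) := by
      have h1 : Continuous fun z : FEHilbert M × FEHilbert M =>
          δ⁻¹ * B₂ * ‖z.2 - v₀‖ + δ⁻¹ * B₃ * (c * ‖v₀‖) * ‖z.1 - u₀‖ := by fun_prop
      have h2 := h1.tendsto (u₀, v₀)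
      simpa using h2
    refine squeeze_zero (fun _ => norm_nonneg _) (fun z => ?_) hlim
    have h3 : df z.1 z.2 - df u₀ v₀ = df z.1 (z.2 - v₀) + (df z.1 v₀ - df u₀ v₀) := by
      rw [← hdf_sub_right]
      abel
    rw [h3]
    exact (norm_add_le _ _).trans (add_le_add (hdf_bound _ _) (hdf_lip _ _ _))
  refine ⟨{ A := LinearMap.toContinuousLinearMap AL
            f := f
            df := df
            A_symm := fun u v => ?_
            A_coercive := fun u => ?_
            f_lipschitz := fun u v => ?_
            df_symm := fun u v w => ?_
            df_bound := hdf_bound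
            df_continuous := hdf_cont
            f_taylor := ⟨δ⁻¹ * B₃ * c, fun u h => ?_⟩ }, fun u v => ?_, fun u v => ?_⟩
  · exact (hA u v).trans ((by rw [hform_comm]) : _ = _) |>.trans (hA v u).symm
  · refine le_trans ?_ (hA u u).ge
    rw [norm_sq_eq_l2Inner]
    exact mul_le_mul_of_nonneg_left (l2Inner_self_le_l2Inner_feDeriv hM _) hδ.le
  · simp only [hf]
    rw [feProj_sub (hkc u).continuousOn (hkc v).continuousOn]
    refine norm_feProj_le ((hkc u).fun_sub (hkc v)).continuousOn (by positivity) (u - v) fun x => ?_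
    rw [← mul_sub, abs_mul, abs_of_pos hδi, mul_assoc]
    exact mul_le_mul_of_nonneg_left (hV.lipschitz_deriv _ _) hδi.le
  · simp only [hdf]
    rw [inner_feProj (hdc u v).continuousOn, inner_feProj (hdc u w).continuousOn, l2Inner, l2Inner]
    refine intervalIntegral.integral_congr fun x _ => ?_
    ring
  · simp only [hf, hdf]
    rw [feProj_sub (hkc (u + h)).continuousOn (hkc u).continuousOn,
      feProj_sub ((hkc (u + h)).fun_sub (hkc u)).continuousOn (hdc u h).continuousOn,
      pow_two, ← mul_assoc]
    refine norm_feProj_le (((hkc (u + h)).fun_sub (hkc u)).fun_sub (hdc u h)).continuousOn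
      (by positivity) h
      fun x => ?_
    have h1 : hFun (u + h) x = hFun u x + hFun h x := rfl
    rw [← mul_sub, ← mul_sub, abs_mul, abs_of_pos hδi, h1]
    calc δ⁻¹ * |deriv V (hFun u x + hFun h x) - deriv V (hFun u x) -
            deriv (deriv V) (hFun u x) * hFun h x|
        ≤ δ⁻¹ * (B₃ * |hFun h x| * |hFun h x|) :=
          mul_le_mul_of_nonneg_left (hV.taylor _ _) hδi.le
      _ ≤ δ⁻¹ * (B₃ * (c * ‖h‖) * |hFun h x|) := by
          gcongr
          exact hc h x
      _ = δ⁻¹ * B₃ * c * ‖h‖ * |hFun h x| := by ring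
  · exact hA _ _
  · exact (inner_feProj (hkc _).continuousOn _).trans (l2Inner_const_mul_left _ _ _)

/-! ### Comparison of the value functions -/

theorem toHilbert_sub (φ ψ : feSpace M) :
    toHilbert M (φ - ψ) = toHilbert M φ - toHilbert M ψ := rfl

theorem runningCost_eq (α : feSpace M) : runningCost α = ‖toHilbert M α‖ ^ 2 / 2 := by
  rw [runningCost, l2Norm_sq, norm_toHilbert_sq]

theorem runningCost_nonneg (α : feSpace M) : 0 ≤ runningCost α := by
  rw [runningCost]
  positivity

theorem finalCost_nonneg {K : ℝ} (hK : 0 ≤ K) (φm : ℝ → ℝ) (φ : feSpace M) :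
    0 ≤ finalCost K φm φ :=
  mul_nonneg hK (sq_nonneg _)

theorem eulerValue_le {δ K T : ℝ} {V φm : ℝ → ℝ} (hK : 0 ≤ K) (hT : 0 ≤ T) {N : ℕ}
    {φ₀ : feSpace M} {α φ : ℕ → feSpace M} (h : IsEulerState δ V T N φ₀ 0 α φ) :
    eulerValue δ V K φm T N φ₀ 0 ≤ eulerCost K φm T N 0 α φ := by
  refine csInf_le ⟨0, ?_⟩ ⟨α, φ, h, rfl⟩
  rintro _ ⟨β, ψ, _, rfl⟩
  exact add_nonneg (finalCost_nonneg hK _ _)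
    (mul_nonneg (div_nonneg hT N.cast_nonneg) (Finset.sum_nonneg fun _ _ => runningCost_nonneg _))

theorem semiValue_le {δ K T : ℝ} {V φm : ℝ → ℝ} (hK : 0 ≤ K) (hT : 0 ≤ T)
    {φ₀ : feSpace M} {α φ : ℝ → feSpace M} (h : IsSemiAdmissible δ V T φ₀ 0 α φ) :
    semiValue δ V K φm T φ₀ 0 ≤ semiCost K φm T 0 α φ := by
  refine csInf_le ⟨0, ?_⟩ ⟨α, φ, h, rfl⟩
  rintro _ ⟨β, ψ, _, rfl⟩
  exact add_nonneg (finalCost_nonneg hK _ _)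
    (intervalIntegral.integral_nonneg hT fun _ _ => runningCost_nonneg _)

/-- Up to an additive constant the final cost is a squared distance in `FEHilbert M`. -/
theorem finalCost_eq [FiniteDimensional ℝ (FEHilbert M)] (K : ℝ) {φm : ℝ → ℝ}
    (hφm : ContinuousOn φm (Set.Icc 0 1)) (φ : feSpace M) :
    finalCost K φm φ = K * ‖toHilbert M φ - feProj M φm‖ ^ 2 +
      K * (l2Inner φm φm - ‖feProj M φm‖ ^ 2) := by
  have hφ := (continuous_feFun φ).continuousOn (s := Set.Icc 0 1)
  have h1 : l2Inner (feFun φ) φm = ⟪toHilbert M φ, feProj M φm⟫_ℝ := by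
    rw [real_inner_comm, inner_feProj hφm, l2Inner_comm]
    rfl
  have h2 : l2Inner (fun x => feFun φ x - φm x) (fun x => feFun φ x - φm x) =
      l2Inner (feFun φ) (feFun φ) - 2 * l2Inner (feFun φ) φm + l2Inner φm φm := by
    rw [l2Inner_sub_left hφ hφm (hφ.fun_sub hφm), l2Inner_comm (feFun φ), l2Inner_comm φm,
      l2Inner_sub_left hφ hφm hφ, l2Inner_sub_left hφ hφm hφm, l2Inner_comm φm (feFun φ)]
    ring
  rw [finalCost, l2Norm_sq, h2, norm_sub_sq_real, norm_toHilbert_sq, h1]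
  ring

theorem weakRHS_zero_of_isStationary {δ : ℝ} {V : ℝ → ℝ} {φ₀ : feSpace M}
    (h : IsStationary δ V φ₀) (v : feSpace M) : weakRHS δ V φ₀ 0 v = 0 := by
  have h1 := h v
  have h2 : l2Inner (fun x => -δ⁻¹ * deriv V (feFun φ₀ x) + feFun (0 : feSpace M) x) (feFun v) =
      -δ⁻¹ * l2Inner (fun x => deriv V (feFun φ₀ x)) (feFun v) := by
    simp only [feFun_zero, add_zero]
    exact l2Inner_const_mul_left _ _ _
  rw [weakRHS, h2]
  linarith

/-- Stationary states are bounded in `L²`, uniformly in the mesh: testing the stationarity condition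
with the state itself bounds its energy, and Poincaré's inequality applies. -/
theorem l2Inner_self_le_of_isStationary (hM : 1 ≤ M) {δ : ℝ} (hδ : 0 < δ) {V : ℝ → ℝ}
    {B₁ B₂ B₃ : ℝ} (hV : PotentialBounds V B₁ B₂ B₃) {φ₀ : feSpace M}
    (h : IsStationary δ V φ₀) :
    l2Inner (feFun φ₀) (feFun φ₀) ≤ (δ⁻¹ * (δ⁻¹ * B₁)) ^ 2 := by
  have hk : Continuous fun x => -(δ⁻¹ * δ⁻¹) * deriv V (feFun φ₀ x) :=
    (hV.continuous_deriv.comp (continuous_feFun φ₀)).const_mul _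
  have hB₁ : 0 ≤ B₁ := (abs_nonneg _).trans (hV.abs_deriv_le 0)
  have hδi : 0 < δ⁻¹ := inv_pos.2 hδ
  have h1 : l2Inner (feDeriv φ₀) (feDeriv φ₀) =
      l2Inner (fun x => -(δ⁻¹ * δ⁻¹) * deriv V (feFun φ₀ x)) (feFun φ₀) := by
    have h2 := h φ₀
    rw [l2Inner_const_mul_left]
    have h3 : δ⁻¹ * (δ * l2Inner (feDeriv φ₀) (feDeriv φ₀)) = l2Inner (feDeriv φ₀) (feDeriv φ₀) :=
      inv_mul_cancel_left₀ hδ.ne' _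
    rw [← h3, eq_neg_of_add_eq_zero_left h2]
    ring
  have h4 := two_mul_l2Inner_le hk.continuousOn (continuous_feFun φ₀).continuousOn
  have h5 : l2Inner (fun x => -(δ⁻¹ * δ⁻¹) * deriv V (feFun φ₀ x))
      (fun x => -(δ⁻¹ * δ⁻¹) * deriv V (feFun φ₀ x)) ≤ (δ⁻¹ * (δ⁻¹ * B₁)) ^ 2 := by
    refine (l2Inner_self_mono hk.continuousOn (g := fun _ => δ⁻¹ * (δ⁻¹ * B₁))
      continuousOn_const fun x _ => ?_).trans (le_of_eq ?_)
    · rw [abs_mul, abs_neg, abs_of_pos (mul_pos hδi hδi),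
        abs_of_nonneg (a := δ⁻¹ * (δ⁻¹ * B₁)) (by positivity), mul_assoc]
      gcongr
      exact hV.abs_deriv_le _
    · rw [l2Inner, intervalIntegral.integral_const, smul_eq_mul]
      ring
  have h6 := l2Inner_self_le_l2Inner_feDeriv hM φ₀
  linarith

/-- The continuous extension to `ℝ` of a curve on `[0, T]`, seen in `FEHilbert M`. -/
noncomputable def extendCurve {T : ℝ} (hT : 0 ≤ T) (α : ℝ → feSpace M) (t : ℝ) : FEHilbert M :=
  toHilbert M (α (Set.projIcc 0 T hT t))

theorem continuous_extendCurve {T : ℝ} (hT : 0 ≤ T) {α : ℝ → feSpace M}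
    (hα : ContinuousOn α (Set.Icc 0 T)) : Continuous (extendCurve hT α) :=
  continuous_toHilbert.comp
    ((continuousOn_iff_continuous_domRestrict.1 hα).comp continuous_projIcc)

theorem extendCurve_of_mem {T : ℝ} (hT : 0 ≤ T) (α : ℝ → feSpace M) {t : ℝ}
    (ht : t ∈ Set.Icc 0 T) : extendCurve hT α t = toHilbert M (α t) := by
  rw [extendCurve, Set.projIcc_of_mem hT ht]

section Transfer

variable {δ L : ℝ} {V : ℝ → ℝ}
  (S : ParabolicSystem (FEHilbert M) δ L)

/-- The parabolic system `S` is the abstract form of the semidiscrete equation. -/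
structure Represents (V : ℝ → ℝ) : Prop where
  continuous_deriv : Continuous (deriv V)
  inner_A : ∀ u v : feSpace M, ⟪S.A (toHilbert M u), toHilbert M v⟫_ℝ =
    δ * l2Inner (feDeriv u) (feDeriv v)
  inner_f : ∀ u v : feSpace M, ⟪S.f (toHilbert M u), toHilbert M v⟫_ℝ =
    δ⁻¹ * l2Inner (fun x => deriv V (feFun u x)) (feFun v)

variable {S}

theorem Represents.weakRHS_eq (hS : Represents S V) (φ α v : feSpace M) :
    weakRHS δ V φ α v =
      ⟪-S.A (toHilbert M φ) - S.f (toHilbert M φ) + toHilbert M α, toHilbert M v⟫_ℝ := by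
  have hk : Continuous fun x => -δ⁻¹ * deriv V (feFun φ x) :=
    (hS.continuous_deriv.comp (continuous_feFun φ)).const_mul _
  rw [inner_add_left, inner_sub_left, inner_neg_left, hS.inner_A, hS.inner_f, inner_toHilbert,
    weakRHS, l2Inner_add_left hk.continuousOn (continuous_feFun α).continuousOn
      (continuous_feFun v).continuousOn, l2Inner_const_mul_left]
  ring

theorem Represents.isEuler (hS : Represents S V) {T : ℝ} {N : ℕ} {φ₀ : feSpace M}
    {α φ : ℕ → feSpace M} (h : IsEulerState δ V T N φ₀ 0 α φ) :
    S.IsEuler (T / N) N (fun n => toHilbert M (α n)) (fun n => toHilbert M (φ n)) := by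
  intro n hn
  refine ext_inner_right ℝ fun v => ?_
  have h1 := h.2 n n.zero_le hn ((toHilbert M).symm v)
  rw [hS.weakRHS_eq, ← inner_toHilbert, ← inner_toHilbert, LinearEquiv.apply_symm_apply] at h1
  rw [inner_add_left, real_inner_smul_left]
  exact h1

/-- The growth condition bounds the velocities of the Euler interpolant in the energy form. -/
theorem Represents.velocity_le (hM : 1 ≤ M) (hS : Represents S V) (hδ : 0 < δ) {τ C : ℝ}
    (hτ : 0 < τ) {N : ℕ} {α : ℕ → FEHilbert M} {φ : ℕ → feSpace M}
    (hE : S.IsEuler τ N α fun n => toHilbert M (φ n))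
    (h : ∀ n < N, l2Norm (fun x => feDeriv (φ (n + 1)) x - feDeriv (φ n) x) ≤ C * τ) :
    ∀ n < N, ⟪S.A (S.velocity α (fun n => toHilbert M (φ n)) n),
      S.velocity α (fun n => toHilbert M (φ n)) n⟫_ℝ ≤ δ * C ^ 2 := by
  intro n hn
  set v := S.velocity α (fun n => toHilbert M (φ n)) n with hv
  have h1 : toHilbert M (φ (n + 1) - φ n) = τ • v := by
    rw [toHilbert_sub]
    exact sub_eq_iff_eq_add'.2 (hE n hn)
  have h2 := hS.inner_A (φ (n + 1) - φ n) (φ (n + 1) - φ n)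
  rw [← l2Norm_feDeriv_sub_sq hM, h1, map_smul, real_inner_smul_left, real_inner_smul_right] at h2
  have h3 := pow_le_pow_left₀ (Real.sqrt_nonneg _) (h n hn) 2
  have h4 : τ ^ 2 * ⟪S.A v, v⟫_ℝ ≤ τ ^ 2 * (δ * C ^ 2) := by
    have h5 := mul_le_mul_of_nonneg_left h3 hδ.le
    have h6 : τ ^ 2 * ⟪S.A v, v⟫_ℝ = τ * (τ * ⟪S.A v, v⟫_ℝ) := by ring
    rw [h6, h2]
    refine h5.trans (le_of_eq ?_)
    ring
  exact le_of_mul_le_mul_left h4 (by positivity)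

variable [FiniteDimensional ℝ (FEHilbert M)]

/-- A semidiscrete state solves the abstract integrated equation. -/
theorem Represents.isState (hS : Represents S V) {T : ℝ} (hT : 0 ≤ T) {φ₀ : feSpace M}
    {α φ : ℝ → feSpace M} (hα : ContinuousOn α (Set.Icc 0 T))
    (h : IsSemiState δ V T φ₀ 0 α φ) :
    S.IsState T (extendCurve hT α) (extendCurve hT φ) := by
  have _ : CompleteSpace (FEHilbert M) := FiniteDimensional.complete ℝ _
  have hαc := continuous_extendCurve hT hα
  have hφc := continuous_extendCurve hT h.continuousOn
  have hf := S.f_continuous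
  intro t ht
  refine ext_inner_right ℝ fun v => ?_
  have h1 := h.evol t ht ((toHilbert M).symm v)
  rw [← inner_toHilbert, ← inner_toHilbert, LinearEquiv.apply_symm_apply] at h1
  rw [extendCurve_of_mem hT φ ht, extendCurve_of_mem hT φ ⟨le_rfl, hT⟩, h.init, h1,
    inner_add_left]
  congr 1
  have hc : Continuous fun s =>
      -S.A (extendCurve hT φ s) - S.f (extendCurve hT φ s) + extendCurve hT α s := by fun_prop
  have h2 := (innerSL ℝ v).intervalIntegral_comp_comm (μ := MeasureTheory.volume)
    (hc.intervalIntegrable 0 t)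
  simp only [innerSL_apply_apply] at h2
  rw [real_inner_comm, ← h2]
  refine intervalIntegral.integral_congr fun s hs => ?_
  rw [Set.uIcc_of_le ht.1] at hs
  have hs' : s ∈ Set.Icc 0 T := ⟨hs.1, hs.2.trans ht.2⟩
  rw [hS.weakRHS_eq, LinearEquiv.apply_symm_apply, extendCurve_of_mem hT φ hs',
    extendCurve_of_mem hT α hs', real_inner_comm]

/-- A solution of the abstract integrated equation gives an admissible semidiscrete pair. -/
theorem Represents.isSemiAdmissible (hS : Represents S V) {T : ℝ} {φ₀ : feSpace M}
    {α φ : ℝ → FEHilbert M}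
    (hα : MeasureTheory.MemLp α 2 (MeasureTheory.volume.restrict (Set.Ioc 0 T)))
    (hφ : Continuous φ) (h0 : φ 0 = toHilbert M φ₀) (h : S.IsState T α φ) :
    IsSemiAdmissible δ V T φ₀ 0 (fun t => (toHilbert M).symm (α t))
      (fun t => (toHilbert M).symm (φ t)) := by
  have _ : CompleteSpace (FEHilbert M) := FiniteDimensional.complete ℝ _
  have hf := S.f_continuous
  refine ⟨?_, (continuous_toHilbert_symm.comp hφ).continuousOn, ?_, ?_⟩
  · obtain ⟨c, hc0, hc⟩ := exists_abs_hFun_le (M := M)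
    have hm := continuous_toHilbert_symm.comp_aestronglyMeasurable hα.aestronglyMeasurable
    refine MeasureTheory.MemLp.of_le_mul (E := feSpace M) (c := c) hα hm
      (Filter.Eventually.of_forall fun t => ?_)
    exact (BoundedContinuousFunction.norm_le (by positivity)).2 fun x => hc (α t) x
  · exact (congrArg (toHilbert M).symm h0).trans (LinearEquiv.symm_apply_apply _ _)
  · intro t ht v
    have hαi : IntervalIntegrable α MeasureTheory.volume 0 t := by
      rw [intervalIntegrable_iff_integrableOn_Ioc_of_le ht.1]
      exact (MeasureTheory.IntegrableOn.mono_set (hα.integrable (by norm_num))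
        (Set.Ioc_subset_Ioc_right ht.2))
    have hc : Continuous fun s => -S.A (φ s) - S.f (φ s) := by fun_prop
    have h2 := (innerSL ℝ (toHilbert M v)).intervalIntegral_comp_comm
      (μ := MeasureTheory.volume) ((hc.intervalIntegrable 0 t).add hαi)
    simp only [innerSL_apply_apply] at h2
    simp only [hS.weakRHS_eq, ← inner_toHilbert, LinearEquiv.apply_symm_apply]
    rw [← h0, h t ht, inner_add_left, real_inner_comm _ (∫ s in (0 : ℝ)..t, _)]
    refine congrArg _ (h2.symm.trans ?_)
    simp only [real_inner_comm]

theorem memLp_of_continuous {T : ℝ} {α : ℝ → FEHilbert M} (hα : Continuous α) :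
    MeasureTheory.MemLp α 2 (MeasureTheory.volume.restrict (Set.Ioc 0 T)) := by
  obtain ⟨b, hb⟩ := (isCompact_Icc (a := (0 : ℝ)) (b := T)).exists_bound_of_continuousOn
    hα.continuousOn
  refine MeasureTheory.MemLp.of_bound hα.aestronglyMeasurable b ?_
  filter_upwards [MeasureTheory.ae_restrict_mem measurableSet_Ioc] with t ht
  exact hb t ⟨ht.1.le, ht.2⟩

end Transfer

/-- Without control a stationary state persists in the Euler scheme. -/
theorem eulerValue_le_finalCost {δ K T : ℝ} {V φm : ℝ → ℝ} {N : ℕ} {φ₀ : feSpace M}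
    (hK : 0 ≤ K) (hT : 0 ≤ T) (hst : IsStationary δ V φ₀) :
    eulerValue δ V K φm T N φ₀ 0 ≤ finalCost K φm φ₀ := by
  refine (eulerValue_le (α := fun _ => 0) (φ := fun _ => φ₀) hK hT
    ⟨rfl, fun n _ _ v => ?_⟩).trans (le_of_eq ?_)
  · rw [weakRHS_zero_of_isStationary hst, mul_zero, add_zero]
  · simp [eulerCost, runningCost_eq]

/-- Without control a stationary state persists in the semidiscrete equation. -/
theorem semiValue_le_finalCost {δ K T : ℝ} {V φm : ℝ → ℝ} {φ₀ : feSpace M} (hK : 0 ≤ K)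
    (hT : 0 ≤ T) (hst : IsStationary δ V φ₀) :
    semiValue δ V K φm T φ₀ 0 ≤ finalCost K φm φ₀ := by
  refine (semiValue_le (α := fun _ => 0) (φ := fun _ => φ₀) hK hT
    ⟨MeasureTheory.memLp_const (0 : feSpace M), continuousOn_const, rfl,
      fun t _ v => ?_⟩).trans (le_of_eq ?_)
  · simp only [weakRHS_zero_of_isStationary hst, intervalIntegral.integral_zero, add_zero]
  · simp [semiCost, runningCost_eq]

section Comparison

variable [FiniteDimensional ℝ (FEHilbert M)] {δ L T K C R : ℝ} {V φm : ℝ → ℝ}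
  {S : ParabolicSystem (FEHilbert M) δ L} {N : ℕ} {φ₀ : feSpace M}

theorem eulerCost_eq (hφm : ContinuousOn φm (Set.Icc 0 1)) (α φ : ℕ → feSpace M) :
    eulerCost K φm T N 0 α φ = K * ‖toHilbert M (φ N) - feProj M φm‖ ^ 2 +
      T / N * ∑ n ∈ Finset.range N, ‖toHilbert M (α n)‖ ^ 2 / 2 +
      K * (l2Inner φm φm - ‖feProj M φm‖ ^ 2) := by
  rw [eulerCost, finalCost_eq K hφm, Nat.Ico_zero_eq_range]
  simp only [runningCost_eq]
  ring

theorem semiCost_eq (hφm : ContinuousOn φm (Set.Icc 0 1)) (α φ : ℝ → feSpace M) :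
    semiCost K φm T 0 α φ = K * ‖toHilbert M (φ T) - feProj M φm‖ ^ 2 +
      (∫ t in (0 : ℝ)..T, ‖toHilbert M (α t)‖ ^ 2 / 2) +
      K * (l2Inner φm φm - ‖feProj M φm‖ ^ 2) := by
  rw [semiCost, finalCost_eq K hφm]
  simp only [runningCost_eq]
  ring

theorem semiValue_le_eulerValue_add (hM : 1 ≤ M) (hN : 1 ≤ N) (hS : Represents S V)
    (hδ : 0 < δ) (hL : 0 ≤ L) (hT : 0 < T) (hK : 0 < K) (hφm : ContinuousOn φm (Set.Icc 0 1))
    (hst : IsStationary δ V φ₀) (hR : K * ‖toHilbert M φ₀ - feProj M φm‖ ^ 2 ≤ R)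
    {α φ : ℕ → feSpace M} (hopt : IsEulerOptimal δ V K φm T N φ₀ 0 α φ)
    (hinc : ∀ n < N, l2Norm (fun x => feDeriv (φ (n + 1)) x - feDeriv (φ n) x) ≤ C * (T / N))
    {c₁ c₂ : ℝ} (hc₁ : c₁ = Real.sqrt (δ * C ^ 2 / 2 * T)) (hc₂ : c₂ = L * (c₁ + |C|)) :
    semiValue δ V K φm T φ₀ 0 ≤ eulerValue δ V K φm T N φ₀ 0 +
      ((c₁ * (K + R) + K * c₁ ^ 2 * T) + (c₂ * (T / 2 + R) + c₂ ^ 2 / 2 * T * T)) * (T / N) := by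
  have _ : CompleteSpace (FEHilbert M) := FiniteDimensional.complete ℝ _
  have hτ : 0 < T / N := div_pos hT (by exact_mod_cast hN)
  have hE := hS.isEuler hopt.1
  have hcost := hopt.2
  have hle := eulerValue_le_finalCost (φm := φm) (N := N) hK.le hT.le hst
  rw [eulerCost_eq hφm] at hcost
  rw [finalCost_eq K hφm, ← hcost] at hle
  obtain ⟨β, y, hyc, hy0, hβ, hy, hβy⟩ := S.exists_state_cost_le hδ hL hT hK hN
    (p := feProj M φm) (R := R) hE (hS.velocity_le hM hδ hτ hE hinc) (by linarith) hc₁ hc₂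
  have hadm := hS.isSemiAdmissible (φ₀ := φ₀) hβ hyc (by rw [hy0, hopt.1.1]) hy
  have h1 := semiValue_le (φm := φm) hK.le hT.le hadm
  rw [semiCost_eq hφm] at h1
  simp only [LinearEquiv.apply_symm_apply] at h1
  linarith

theorem eulerValue_le_semiValue_add (hM : 1 ≤ M) (hN : 1 ≤ N) (hS : Represents S V)
    (hδ : 0 < δ) (hL : 0 ≤ L) (hT : 0 < T) (hK : 0 < K) (hφm : ContinuousOn φm (Set.Icc 0 1))
    (hst : IsStationary δ V φ₀) (hR : K * ‖toHilbert M φ₀ - feProj M φm‖ ^ 2 ≤ R)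
    {α φ : ℝ → feSpace M} {φr : ℕ → feSpace M} (hopt : IsSemiOptimal δ V K φm T φ₀ 0 α φ)
    (hα : ContinuousOn α (Set.Icc 0 T))
    (hr : IsEulerState δ V T N φ₀ 0 (fun n => α (n * (T / N))) φr)
    (hinc : ∀ n < N, l2Norm (fun x => feDeriv (φr (n + 1)) x - feDeriv (φr n) x) ≤ C * (T / N))
    {c : ℝ} (hc : c = Real.sqrt (Real.exp (4 * L * T) *
      ((δ + L) * C ^ 2 * T + (2 * K * R + 4 * L * R)))) :
    eulerValue δ V K φm T N φ₀ 0 ≤ semiValue δ V K φm T φ₀ 0 +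
      ((c * (K + R) + K * c ^ 2 * T) + 2 * L * R) * (T / N) := by
  have _ : CompleteSpace (FEHilbert M) := FiniteDimensional.complete ℝ _
  have hN0 : (0 : ℝ) < N := by exact_mod_cast hN
  have hτ : 0 < T / N := div_pos hT hN0
  have hT0 : T ∈ Set.Icc 0 T := ⟨hT.le, le_rfl⟩
  have h00 : (0 : ℝ) ∈ Set.Icc 0 T := ⟨le_rfl, hT.le⟩
  have hφc := hopt.1.2.continuousOn
  set a := extendCurve hT.le α with ha
  set f := extendCurve hT.le φ with hf
  have hint : ∫ t in (0 : ℝ)..T, ‖toHilbert M (α t)‖ ^ 2 / 2 =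
      ∫ t in (0 : ℝ)..T, ‖a t‖ ^ 2 / 2 := by
    refine intervalIntegral.integral_congr fun t ht => ?_
    rw [Set.uIcc_of_le hT.le] at ht
    rw [ha, extendCurve_of_mem hT.le α ht]
  have hcost := hopt.2
  rw [semiCost_eq hφm, hint, ← extendCurve_of_mem hT.le φ hT0, ← hf] at hcost
  have hf0 : f 0 = toHilbert M φ₀ := by
    rw [hf, extendCurve_of_mem hT.le φ h00, hopt.1.2.init]
  have hle := semiValue_le_finalCost (φm := φm) hK.le hT.le hst
  rw [finalCost_eq K hφm, ← hcost] at hle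
  have hopt' : S.IsOptimal T K (feProj M φm) a f := by
    intro β ψ hβ hψ h0 hψst
    have h1 := semiValue_le (φm := φm) hK.le hT.le
      (hS.isSemiAdmissible (memLp_of_continuous hβ) hψ (h0.trans hf0) hψst)
    rw [semiCost_eq hφm, ← hcost] at h1
    simp only [LinearEquiv.apply_symm_apply] at h1
    linarith
  have hgrid : ∀ n ≤ N, a (n * (T / N)) = toHilbert M (α (n * (T / N))) := by
    intro n hn
    refine extendCurve_of_mem hT.le α ⟨by positivity, ?_⟩
    have h1 : (n : ℝ) ≤ N := by exact_mod_cast hn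
    calc (n : ℝ) * (T / N) ≤ N * (T / N) := mul_le_mul_of_nonneg_right h1 hτ.le
      _ = T := mul_div_cancel₀ T hN0.ne'
  have hE : S.IsEuler (T / N) N (fun n => a (n * (T / N))) fun n => toHilbert M (φr n) := by
    intro n hn
    rw [hS.isEuler hr n hn]
    simp only [ParabolicSystem.velocity, hgrid n hn.le]
  have h2 := S.euler_cost_le hδ hL hT hK hN (p := feProj M φm) (R := R)
    (continuous_extendCurve hT.le hα) (continuous_extendCurve hT.le hφc)
    (hS.isState hT.le hα hopt.1.2) hopt' (by rw [← hf, hf0, hr.1]) hE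
    (hS.velocity_le hM hδ hτ hE hinc) (by linarith) hc
  have h3 := eulerValue_le (φm := φm) hK.le hT.le hr
  rw [eulerCost_eq hφm] at h3
  have h4 : ∑ n ∈ Finset.range N, ‖a (n * (T / N))‖ ^ 2 / 2 =
      ∑ n ∈ Finset.range N, ‖toHilbert M (α (n * (T / N)))‖ ^ 2 / 2 :=
    Finset.sum_congr rfl fun n hn => by rw [hgrid n (Finset.mem_range.1 hn).le]
  rw [h4] at h2
  linarith

end Comparison

end GinzburgLandau

open GinzburgLandau in
theorem mainTheorem3
    (δ T K : ℝ) (hδ : 0 < δ) (hT : 0 < T) (hK : 0 < K)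
    (V : ℝ → ℝ) (hV : ContDiff ℝ 3 V)
    (hVb : ∀ k : ℕ, 1 ≤ k → k ≤ 3 → ∃ B : ℝ, ∀ x : ℝ, |iteratedDeriv k V x| ≤ B)
    (φm : ℝ → ℝ) (hφm : ContDiffOn ℝ 2 φm (Set.Icc 0 1)) (hφm0 : φm 0 = 0) (hφm1 : φm 1 = 0)
    (C : ℝ) :
    ∃ D : ℝ, ∀ (r : ℝ → ℝ) (φ₀ : ∀ M : ℕ, feSpace M),
      (∀ x : ℝ, 0 < x → 0 < r x) →
      (∀ M : ℕ, 1 ≤ M → IsStationary δ V (φ₀ M)) →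
      (∀ M N : ℕ, 1 ≤ M → 1 ≤ N → T / N ≤ r (1 / M) →
        GradIncrease δ V K φm T N (φ₀ M) C) →
      ∀ M N : ℕ, 1 ≤ M → 1 ≤ N → T / N ≤ r (1 / M) →
        |eulerValue δ V K φm T N (φ₀ M) 0 - semiValue δ V K φm T (φ₀ M) 0| ≤ D * (T / N) := by
  obtain ⟨B₁, B₂, B₃, hB⟩ := exists_potentialBounds hV hVb
  have hB₂ : 0 ≤ B₂ := (abs_nonneg _).trans (hB.abs_deriv2_le 0)
  have hL : 0 ≤ δ⁻¹ * B₂ := mul_nonneg (inv_pos.2 hδ).le hB₂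
  set L := δ⁻¹ * B₂ with hLdef
  -- An upper bound for the cost of doing nothing, uniform in the mesh.
  set R := K * (2 * ((δ⁻¹ * (δ⁻¹ * B₁)) ^ 2 + l2Inner φm φm)) with hRdef
  obtain ⟨c₁, hc₁⟩ : ∃ c, c = Real.sqrt (δ * C ^ 2 / 2 * T) := ⟨_, rfl⟩
  obtain ⟨c₂, hc₂⟩ : ∃ c, c = L * (c₁ + |C|) := ⟨_, rfl⟩
  obtain ⟨c, hc⟩ : ∃ c, c = Real.sqrt (Real.exp (4 * L * T) *
      ((δ + L) * C ^ 2 * T + (2 * K * R + 4 * L * R))) := ⟨_, rfl⟩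
  refine ⟨max ((c₁ * (K + R) + K * c₁ ^ 2 * T) + (c₂ * (T / 2 + R) + c₂ ^ 2 / 2 * T * T))
    ((c * (K + R) + K * c ^ 2 * T) + 2 * L * R), fun r φ₀ _ hst hgrad M N hM hN hr => ?_⟩
  obtain ⟨αt, φt, αb, φb, φr, hαt, hαb, hαbc, hφr, hinc⟩ := hgrad M N hM hN hr
  have _ : FiniteDimensional ℝ (FEHilbert M) := finiteDimensional_FEHilbert hM
  obtain ⟨S, hSA, hSf⟩ := exists_parabolicSystem hM hδ hB
  have hS : Represents S V := ⟨hB.continuous_deriv, hSA, hSf⟩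
  have hφmc : ContinuousOn φm (Set.Icc 0 1) := hφm.continuousOn
  have hR : K * ‖toHilbert M (φ₀ M) - feProj M φm‖ ^ 2 ≤ R := by
    refine mul_le_mul_of_nonneg_left ?_ hK.le
    have h1 := l2Inner_self_le_of_isStationary hM hδ hB (hst M hM)
    rw [← norm_toHilbert_sq] at h1
    have h2 := norm_feProj_sq_le (M := M) hφmc
    have h3 := parallelogram_law_with_norm ℝ (toHilbert M (φ₀ M)) (feProj M φm)
    have h4 := mul_self_nonneg ‖toHilbert M (φ₀ M) + feProj M φm‖
    nlinarith
  have hτ : 0 ≤ T / N := div_nonneg hT.le N.cast_nonneg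
  have h1 := semiValue_le_eulerValue_add (C := C) hM hN hS hδ hL hT hK hφmc (hst M hM) hR hαt
    (fun n hn => le_trans (le_add_of_nonneg_right (Real.sqrt_nonneg _)) (hinc n hn)) hc₁ hc₂
  have h2 := eulerValue_le_semiValue_add (C := C) hM hN hS hδ hL hT hK hφmc (hst M hM) hR hαb
    hαbc hφr
    (fun n hn => le_trans (le_add_of_nonneg_left (Real.sqrt_nonneg _)) (hinc n hn)) hc
  refine abs_sub_le_iff.2 ⟨?_, ?_⟩
  · have := mul_le_mul_of_nonneg_right (le_max_right
      ((c₁ * (K + R) + K * c₁ ^ 2 * T) + (c₂ * (T / 2 + R) + c₂ ^ 2 / 2 * T * T))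
      ((c * (K + R) + K * c ^ 2 * T) + 2 * L * R)) hτ
    linarith
  · have := mul_le_mul_of_nonneg_right (le_max_left
      ((c₁ * (K + R) + K * c₁ ^ 2 * T) + (c₂ * (T / 2 + R) + c₂ ^ 2 / 2 * T * T))
      ((c * (K + R) + K * c ^ 2 * T) + 2 * L * R)) hτ
    linarith
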